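/- Let $k$ be a field and let $G$ be a finite simple graph with vertex set $V$. A set $S\subseteq V$ is stable if no two of its elements are adjacent; write $\rho(S)=\sum_{i\in S}\mathbf e_i\in\mathbb R^V$, let $\mathcal Q_G=\operatorname{conv}\{\rho(S): S\subseteq V\text{ stable}\}$ be the stable set polytope of $G$, and let $$k[\mathcal Q_G]=k\big[\,T\textstyle\prod_{i\in V}X_i^{a_i} : (a_i)_{i\in V}\text{ a vertex of }\mathcal Q_G\,\big]\subseteq k[T,X_i : i\in V]$$ be its toric ring, graded so that each generator $T\prod_i X_i^{a_i}$ has degree $1$. A graded $k$-algebra $R$ is called strongly Koszul with respect to $u_1,\dots,u_t$ if $u_1,\dots,u_t$ is a minimal system of homogeneous generators of the ideal $R_+$ generated by the homogeneous elements of positive degree, and for all $1\le i_1<\dots<i_r\le t$ and all $1\le j\le r$ the ideal $(u_{i_1},\dots,u_{i_{j-1}}):u_{i_j}$ is generated by a subset of $\{u_1,\dots,u_t\}$. The toric ring $k[\mathcal Q_G]$ is called strongly Koszul if it is strongly Koszul with respect to its generators $T\prod_i X_i^{a_i}$, $(a_i)$ a vertex of $\mathcal Q_G$, listed in some order. The graph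 $G$ is called trivially perfect if for every induced subgraph $G_W$ with $\emptyset\ne W\subseteq V$ the maximal cardinality of a stable set of $G_W$ equals the number of inclusion-maximal cliques of $G_W$. A graded $k$-algebra is called trivial if it is isomorphic, as a graded $k$-algebra, to one that is obtained from standard graded polynomial rings over $k$ in finitely many variables by repeatedly forming tensor products $R\otimes_k S$ (graded by total degree) and Segre products $\bigoplus_{n} R_n\otimes_k S_n$. **Theorem.** The following are equivalent: 1. $k[\mathcal Q_G]$ is strongly Koszul; 2. $k[\mathcal Q_G]$ is strongly Koszul with respect to the generators $T\prod_i X_i^{a_i}$, $(a_i)$ a vertex of $\mathcal Q_G$, listed in any order; 3. $G$ is trivially perfect; 4. $G$ contains neither the cycle $C_4$ nor the path $P_4$ on four vertices as an induced subgraph. In particular, if $k[\mathcal Q_G]$ is strongly Koszul, then $k[\mathcal Q_G]$ is trivial. -/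

import Mathlib

open scoped TensorProduct

universe u v w

/-! ### Graphs -/

/-- The incidence vector `ρ(S) = ∑_{i ∈ S} e_i` of a set of vertices. -/
noncomputable def incidenceVector {V : Type v} (S : Set V) : V → ℝ :=
  S.indicator 1

/-- The stable set polytope of `G`: the convex hull of the vectors `ρ(S)`, `S` a stable set. -/
noncomputable def stableSetPolytope {V : Type v} (G : SimpleGraph V) : Set (V → ℝ) :=
  convexHull ℝ {x | ∃ S : Set V, G.IsIndepSet S ∧ x = incidenceVector S}

/-- `m(G)`, the number of (inclusion-)maximal cliques of `G`. -/
noncomputable def numMaximalCliques {V : Type v} (G : SimpleGraph V) : ℕ :=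
  {C : Set V | Maximal (fun D : Set V => G.IsClique D) C}.ncard

/-- `G` is trivially perfect if `α(G_W) = m(G_W)` for every (nonempty) induced subgraph `G_W`. -/
def IsTriviallyPerfect {V : Type v} (G : SimpleGraph V) : Prop :=
  ∀ W : Set V, W.Nonempty → (G.induce W).indepNum = numMaximalCliques (G.induce W)

/-! ### Toric rings -/

/-- The monomial `T · ∏ X_i ^ a_i` of `k[T, X_i : i ∈ V]`; the variable `T` is indexed by `none`,
the variable `X_i` by `some i`. -/
noncomputable def toricMonomial (k : Type u) [Field k] {V : Type v} [Fintype V] (a : V → ℕ) :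
    MvPolynomial (Option V) k :=
  MvPolynomial.X none * ∏ i, MvPolynomial.X (some i) ^ a i

/-- The set of monomials `T · X^a`, `a` a vertex of the polytope `P`
(meant for polytopes with vertices in `ℕ ^ V`). -/
def vertexMonomials (k : Type u) [Field k] {V : Type v} [Fintype V] (P : Set (V → ℝ)) :
    Set (MvPolynomial (Option V) k) :=
  {f | ∃ a : V → ℕ, (fun i => (a i : ℝ)) ∈ Set.extremePoints ℝ P ∧ f = toricMonomial k a}

/-- The toric ring `k[P] = k[T · X^a : a a vertex of P]`. -/
noncomputable def toricRing (k : Type u) [Field k] {V : Type v} [Fintype V] (P : Set (V → ℝ)) :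
    Subalgebra k (MvPolynomial (Option V) k) :=
  Algebra.adjoin k (vertexMonomials k P)

open Classical in
/-- The grading of the toric ring in which every generator `T · X^a` has degree `1`: the degree is
the exponent of `T`. -/
noncomputable def toricGrading (k : Type u) [Field k] {V : Type v} [Fintype V]
    (P : Set (V → ℝ)) (n : ℕ) : Submodule k (toricRing k P) :=
  (MvPolynomial.weightedHomogeneousSubmodule k
    (fun o : Option V => if o = none then (1 : ℕ) else 0) n).comap (toricRing k P).val.toLinearMap

/-! ### Strongly Koszul algebras -/

/-- The ideal `R_+` generated by the homogeneous elements of positive degree. -/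
def irrelevantIdeal {k : Type u} [Field k] {R : Type w} [CommRing R] [Algebra k R]
    (A : ℕ → Submodule k R) : Ideal R :=
  Ideal.span {x | ∃ n, 0 < n ∧ x ∈ A n}

/-- The graded `k`-algebra `R = ⨁ A n` is strongly Koszul with respect to `u_1, …, u_t`:
these form a minimal system of homogeneous generators of `R_+`, and for every subsequence
`u_{i_1}, …, u_{i_r}` with `i_1 < ⋯ < i_r` and every `j = 1, …, r`, the ideal
`(u_{i_1}, …, u_{i_{j-1}}) : u_{i_j}` is generated by a subset of `{u_1, …, u_t}`. -/
structure IsStronglyKoszulWith {k : Type u} [Field k] {R : Type w} [CommRing R] [Algebra k R]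
    (A : ℕ → Submodule k R) {t : ℕ} (u : Fin t → R) : Prop where
  homogeneous : ∀ i, ∃ d, u i ∈ A d
  generates : Ideal.span (Set.range u) = irrelevantIdeal A
  minimal : ∀ i, u i ∉ Ideal.span (u '' {i}ᶜ)
  colon : ∀ (r : ℕ) (s : Fin r → Fin t), StrictMono s → ∀ j : Fin r,
    ∃ B : Set (Fin t),
      (Ideal.span ((fun l => u (s l)) '' Set.Iio j)).colon {u (s j)} = Ideal.span (u '' B)

/-- `u_1, …, u_t` lists, without repetition, the generators `T · X^a` (`a` a vertex of `P`) of the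
toric ring `k[P]`. -/
def ListsVertexMonomials (k : Type u) [Field k] {V : Type v} [Fintype V] (P : Set (V → ℝ))
    {t : ℕ} (u : Fin t → toricRing k P) : Prop :=
  Function.Injective u ∧
    Set.range (fun i => (u i : MvPolynomial (Option V) k)) = vertexMonomials k P

/-- The toric ring `k[P]` is strongly Koszul: it is so with respect to the generators that
correspond to the vertices of `P`, listed in some order. -/
def IsStronglyKoszulToricRing (k : Type u) [Field k] {V : Type v} [Fintype V]
    (P : Set (V → ℝ)) : Prop :=
  ∃ (t : ℕ) (u : Fin t → toricRing k P),
    ListsVertexMonomials k P u ∧ IsStronglyKoszulWith (toricGrading k P) u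

/-! ### Trivial rings -/

section Products

variable {k : Type u} [Field k] {R S : Type w} [CommRing R] [Algebra k R] [CommRing S]
  [Algebra k S]

/-- The subspace `A_i ⊗ B_j` of `R ⊗ S`. -/
def tensorPiece (A : ℕ → Submodule k R) (B : ℕ → Submodule k S) (i j : ℕ) :
    Submodule k (R ⊗[k] S) :=
  Submodule.map₂ (TensorProduct.mk k R S) (A i) (B j)

/-- The grading of the tensor product by total degree: `(R ⊗ S)_n = ⨁_{i + j = n} A_i ⊗ B_j`. -/
def tensorGrading (A : ℕ → Submodule k R) (B : ℕ → Submodule k S) (n : ℕ) :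
    Submodule k (R ⊗[k] S) :=
  ⨆ (i : ℕ) (j : ℕ) (_ : i + j = n), tensorPiece A B i j

/-- The Segre product `⨁_n A_n ⊗ B_n ⊆ R ⊗ S`. -/
def segreProduct (A : ℕ → Submodule k R) (B : ℕ → Submodule k S) : Subalgebra k (R ⊗[k] S) :=
  Algebra.adjoin k {z | ∃ n, z ∈ tensorPiece A B n n}

/-- The grading of the Segre product, with `A_n ⊗ B_n` in degree `n`. -/
def segreGrading (A : ℕ → Submodule k R) (B : ℕ → Submodule k S) (n : ℕ) :
    Submodule k (segreProduct A B) :=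
  (tensorPiece A B n n).comap (segreProduct A B).val.toLinearMap

end Products

/-- The graded `k`-algebras obtained from standard graded polynomial rings in finitely many
variables by repeatedly forming tensor products and Segre products. -/
inductive IsTrivialConstruction (k : Type u) [Field k] :
    (R : Type u) → [CommRing R] → [Algebra k R] → (ℕ → Submodule k R) → Prop
  | polynomial (m : ℕ) :
      IsTrivialConstruction k (MvPolynomial (Fin m) k)
        (MvPolynomial.homogeneousSubmodule (Fin m) k)
  | tensor {R S : Type u} [CommRing R] [Algebra k R] [CommRing S] [Algebra k S]
      {A : ℕ → Submodule k R} {B : ℕ → Submodule k S} :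
      IsTrivialConstruction k R A → IsTrivialConstruction k S B →
        IsTrivialConstruction k (R ⊗[k] S) (tensorGrading A B)
  | segre {R S : Type u} [CommRing R] [Algebra k R] [CommRing S] [Algebra k S]
      {A : ℕ → Submodule k R} {B : ℕ → Submodule k S} :
      IsTrivialConstruction k R A → IsTrivialConstruction k S B →
        IsTrivialConstruction k (segreProduct A B) (segreGrading A B)

/-- A graded `k`-algebra is trivial if it is isomorphic, as a graded `k`-algebra, to one built from
polynomial rings by tensor and Segre products. -/
def IsTrivialRing (k : Type u) [Field k] {R : Type w} [CommRing R] [Algebra k R]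
    (A : ℕ → Submodule k R) : Prop :=
  ∃ (S : Type u) (_ : CommRing S) (_ : Algebra k S) (B : ℕ → Submodule k S),
    IsTrivialConstruction k S B ∧
      ∃ e : R ≃ₐ[k] S, ∀ n, (A n).map e.toLinearMap = B n

-- The vertices of the polytope are exactly the vectors `ρ(S)` with `S` stable, because 0/1 vectors
-- are extreme in the unit cube. Hence the toric ring is the monoid algebra of the cancellative
-- monoid generated by the exponents of the monomials `T · ∏_{i ∈ S} X_i`, and both algebraic
-- properties become questions about this graded monoid.
--
-- In a monomial basis, the colon of an ideal generated by monomials by a monomial is computed on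
-- supports: `(b_1, …, b_l) : a` is the union, monomial by monomial, of the `(b_i) : a`. So strong
-- Koszulness only says that each `(b) : a`, with `a ≠ b` generators, is generated in degree one
-- (`IsStronglyKoszulMonoid`). No order of the generators enters, which gives the equivalence of
-- "some order" and "any order".
--
-- On the graph side, excluding induced `C₄` and `P₄` means that adjacent vertices have comparable
-- closed neighbourhoods. A vertex with the largest closed neighbourhood in a nonempty `W` then
-- either dominates `W`, or its closed neighbourhood is cut off from the rest of `W`. A dominating
-- vertex splits off a factor `ℕ` of the monoid, which is a tensor product with a polynomial ring in
-- one variable; a separation turns the monoid into a fibre product over the degree, which is a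
-- Segre product. Both operations preserve the strong Koszul condition and triviality, so induction
-- on `|W|` gives both. Conversely, an induced `C₄` or `P₄` yields an explicit relation in degree
-- three that violates the condition.
--
-- Trivial perfection is matched through the same comparability: a vertex of a maximal clique with
-- the smallest closed neighbourhood has exactly that clique as closed neighbourhood, and such
-- vertices, one for each maximal clique, form a stable set.

universe x

/-! ### Graded monoids and monomial bases -/

/-- `b` is a basis of the graded algebra `R = ⨁ A n` that identifies `R` with the monoid algebra
of `M`, graded by `d`. -/
structure IsMonomialBasis {k : Type u} [Field k] {M : Type v} [AddCommMonoid M] (d : M →+ ℕ)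
    {R : Type w} [CommRing R] [Algebra k R] (A : ℕ → Submodule k R)
    (b : Module.Basis M k R) : Prop where
  map_zero : b 0 = 1
  map_add : ∀ m n, b (m + n) = b m * b n
  grading : ∀ n, A n = Submodule.span k (b '' {m | d m = n})

/-- The monoid algebra of `M`, graded by `d`, is trivial. -/
def HasTrivialMonoidAlgebra (k : Type u) [Field k] {M : Type v} [AddCommMonoid M]
    (d : M →+ ℕ) : Prop :=
  ∃ (S : Type u) (_ : CommRing S) (_ : Algebra k S) (B : ℕ → Submodule k S),
    IsTrivialConstruction k S B ∧ ∃ b : Module.Basis M k S, IsMonomialBasis d B b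

/-- The graded monoid `M` is generated in degree one. -/
structure IsStandardMonoid {M : Type v} [AddCommMonoid M] (d : M →+ ℕ) : Prop where
  eq_zero : ∀ m, d m = 0 → m = 0
  exists_add : ∀ m, d m ≠ 0 → ∃ g r, d g = 1 ∧ m = g + r

/-- The combinatorial counterpart of strong Koszulness for a graded monoid. -/
def IsStronglyKoszulMonoid {M : Type v} [AddCommMonoid M] (d : M →+ ℕ) : Prop :=
  ∀ a b m m', d a = 1 → d b = 1 → a ≠ b → m + a = b + m' →
    ∃ g r s, d g = 1 ∧ m = g + r ∧ g + a = b + s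

section Transport

variable {M : Type v} {N : Type w} [AddCommMonoid M] [AddCommMonoid N] {d : M →+ ℕ}
  {d' : N →+ ℕ}

theorem IsStronglyKoszulMonoid.of_equiv (h : IsStronglyKoszulMonoid d) (e : M ≃+ N)
    (he : ∀ m, d' (e m) = d m) : IsStronglyKoszulMonoid d' := by
  intro a b m m' ha hb hab hm
  obtain ⟨a, rfl⟩ := e.surjective a
  obtain ⟨b, rfl⟩ := e.surjective b
  obtain ⟨m, rfl⟩ := e.surjective m
  obtain ⟨m', rfl⟩ := e.surjective m'
  rw [he] at ha hb
  rw [← map_add, ← map_add] at hm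
  obtain ⟨g, r, s, hg, hr, hs⟩ :=
    h a b m m' ha hb (fun h => hab (by rw [h])) (e.injective hm)
  exact ⟨e g, e r, e s, by rw [he, hg], by rw [hr, map_add], by rw [← map_add, hs, map_add]⟩

theorem HasTrivialMonoidAlgebra.of_equiv {k : Type u} [Field k]
    (h : HasTrivialMonoidAlgebra k d) (e : M ≃+ N)
    (he : ∀ m, d' (e m) = d m) : HasTrivialMonoidAlgebra k d' := by
  obtain ⟨S, _, _, B, hB, b, hb⟩ := h
  refine ⟨S, _, _, B, hB, b.reindex e.toEquiv, ?_, ?_, fun n => ?_⟩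
  · simp [hb.map_zero]
  · intro m n
    simp [hb.map_add]
  · rw [hb.grading]
    congr 1
    ext x
    constructor
    · rintro ⟨m, hm, rfl⟩
      exact ⟨e m, by simpa [he] using hm, by simp⟩
    · rintro ⟨m, hm, rfl⟩
      obtain ⟨m, rfl⟩ := e.surjective m
      exact ⟨m, by simpa [he] using hm, by simp⟩

end Transport

/-! ### The natural numbers -/

theorem isStandardMonoid_nat : IsStandardMonoid (AddMonoidHom.id ℕ) where
  eq_zero _ h := h
  exists_add m hm := by
    obtain ⟨n, rfl⟩ := Nat.exists_eq_succ_of_ne_zero hm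
    exact ⟨1, n, rfl, by rw [Nat.succ_eq_add_one, add_comm]⟩

theorem isStronglyKoszulMonoid_nat : IsStronglyKoszulMonoid (AddMonoidHom.id ℕ) :=
  fun _ _ _ _ ha hb hab => absurd (ha.trans hb.symm) hab

theorem hasTrivialMonoidAlgebra_nat (k : Type u) [Field k] :
    HasTrivialMonoidAlgebra k (AddMonoidHom.id ℕ) := by
  refine ⟨_, _, _, _, .polynomial 1,
    (MvPolynomial.basisMonomials (Fin 1) k).reindex (Finsupp.uniqueEquiv 0), ?_, ?_, fun n => ?_⟩
  · simp [Finsupp.uniqueEquiv]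
  · intro m n
    simp [Finsupp.uniqueEquiv, MvPolynomial.monomial_mul]
  · rw [MvPolynomial.homogeneousSubmodule_eq_finsupp_supported,
      AddMonoidAlgebra.supported_eq_span_single]
    congr 1
    ext x
    constructor
    · rintro ⟨f, hf, rfl⟩
      refine ⟨f 0, ?_, ?_⟩
      · simpa [Finsupp.degree_eq_sum] using hf
      · have : Finsupp.single 0 (f 0) = f := by
          refine Finsupp.ext fun i => ?_
          rw [Subsingleton.elim i 0, Finsupp.single_eq_same]
        simp [MvPolynomial.single_eq_monomial, Finsupp.uniqueEquiv, this]
    · rintro ⟨m, hm, rfl⟩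
      exact ⟨Finsupp.single 0 m, by simpa using hm,
        by simp [MvPolynomial.single_eq_monomial, Finsupp.uniqueEquiv]⟩

/-! ### Tensor products -/

section Tensor

variable {M : Type v} {N : Type w} [AddCommMonoid M] [AddCommMonoid N] {d : M →+ ℕ}
  {e : N →+ ℕ}

theorem IsStandardMonoid.eq_zero_or_eq_zero_of_coprod_eq_one (hd : IsStandardMonoid d)
    (he : IsStandardMonoid e) {m : M × N} (hm : d.coprod e m = 1) :
    (d m.1 = 1 ∧ m = (m.1, 0)) ∨ (e m.2 = 1 ∧ m = (0, m.2)) := by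
  simp only [AddMonoidHom.coprod_apply] at hm
  rcases Nat.eq_zero_or_pos (e m.2) with h | h
  · exact .inl ⟨by omega, Prod.ext rfl (he.eq_zero _ h)⟩
  · exact .inr ⟨by omega, Prod.ext (hd.eq_zero _ (by omega)) rfl⟩

/-- A degree-one element lives in a single factor. Two generators in the same factor are handled by
that factor; for generators in different factors, `b` itself divides `m`. -/
theorem IsStronglyKoszulMonoid.prod (hd : IsStandardMonoid d) (he : IsStandardMonoid e)
    (kd : IsStronglyKoszulMonoid d) (ke : IsStronglyKoszulMonoid e) :
    IsStronglyKoszulMonoid (d.coprod e) := by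
  rintro ⟨a, a'⟩ ⟨b, b'⟩ ⟨m, m'⟩ ⟨n, n'⟩ ha hb hab hm
  rw [Prod.mk_add_mk, Prod.mk_add_mk, Prod.mk.injEq] at hm
  obtain ⟨hm, hm'⟩ := hm
  rcases hd.eq_zero_or_eq_zero_of_coprod_eq_one he ha with ⟨hda, ha'⟩ | ⟨hda, ha'⟩ <;>
  rcases hd.eq_zero_or_eq_zero_of_coprod_eq_one he hb with ⟨hdb, hb'⟩ | ⟨hdb, hb'⟩ <;>
  simp only [Prod.mk.injEq, true_and, and_true] at hda hdb ha' hb' <;> clear ha hb <;>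
  subst ha' hb'
  · obtain ⟨g, r, s, hg, hr, hs⟩ := kd a b m n hda hdb (fun h => hab (by rw [h])) hm
    exact ⟨(g, 0), (r, m'), (s, 0), by simp [hg], by simp [hr], by simp [hs]⟩
  -- The second coordinate of the relation reads `m' = b' + n'`, so `b` is the required divisor.
  · exact ⟨(0, b'), (m, n'), (a, 0), by simp [hdb], by simpa using hm', by simp⟩
  · exact ⟨(b, 0), (n, m'), (0, a'), by simp [hdb], by simpa using hm, by simp⟩
  · obtain ⟨g, r, s, hg, hr, hs⟩ := ke a' b' m' n' hda hdb (fun h => hab (by rw [h])) hm'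
    exact ⟨(0, g), (m, r), (0, s), by simp [hg], by simp [hr], by simp [hs]⟩

variable {k : Type u} [Field k] {R S : Type x} [CommRing R] [Algebra k R] [CommRing S]
  [Algebra k S] {A : ℕ → Submodule k R} {B : ℕ → Submodule k S}
  {b : Module.Basis M k R} {c : Module.Basis N k S}

theorem IsMonomialBasis.tensorPiece_eq_span (hb : IsMonomialBasis d A b)
    (hc : IsMonomialBasis e B c) (i j : ℕ) :
    tensorPiece A B i j =
      Submodule.span k (b.tensorProduct c '' {m | d m.1 = i ∧ e m.2 = j}) := by
  rw [tensorPiece, hb.grading, hc.grading, Submodule.map₂_span_span]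
  congr 1
  ext x
  constructor
  · rintro ⟨_, ⟨m, hm, rfl⟩, _, ⟨n, hn, rfl⟩, rfl⟩
    exact ⟨(m, n), ⟨hm, hn⟩, by simp⟩
  · rintro ⟨⟨m, n⟩, ⟨hm, hn⟩, rfl⟩
    exact ⟨b m, ⟨m, hm, rfl⟩, c n, ⟨n, hn, rfl⟩, by simp⟩

theorem IsMonomialBasis.tensorProduct_mul (hb : IsMonomialBasis d A b)
    (hc : IsMonomialBasis e B c) (m n : M × N) :
    b.tensorProduct c (m + n) = b.tensorProduct c m * b.tensorProduct c n := by
  simp [Module.Basis.tensorProduct_apply', hb.map_add, hc.map_add]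

theorem IsMonomialBasis.tensorProduct_zero (hb : IsMonomialBasis d A b)
    (hc : IsMonomialBasis e B c) : b.tensorProduct c 0 = 1 := by
  simp [Module.Basis.tensorProduct_apply', hb.map_zero, hc.map_zero,
    Algebra.TensorProduct.one_def]

theorem IsMonomialBasis.tensorProduct (hb : IsMonomialBasis d A b)
    (hc : IsMonomialBasis e B c) :
    IsMonomialBasis (d.coprod e) (tensorGrading A B) (b.tensorProduct c) where
  map_zero := hb.tensorProduct_zero hc
  map_add := hb.tensorProduct_mul hc
  grading n := by
    simp only [tensorGrading, hb.tensorPiece_eq_span hc]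
    apply le_antisymm
    · refine iSup_le fun i => iSup_le fun j => iSup_le fun hij => Submodule.span_mono ?_
      rintro _ ⟨m, ⟨h1, h2⟩, rfl⟩
      exact ⟨m, by simp [h1, h2, hij], rfl⟩
    · rw [Submodule.span_le]
      rintro _ ⟨m, hm, rfl⟩
      have : d m.1 + e m.2 = n := hm
      exact Submodule.mem_iSup_of_mem (d m.1) (Submodule.mem_iSup_of_mem (e m.2)
        (Submodule.mem_iSup_of_mem this (Submodule.subset_span ⟨m, ⟨rfl, rfl⟩, rfl⟩)))

end Tensor

theorem HasTrivialMonoidAlgebra.prod {k : Type u} [Field k] {M : Type v} {N : Type w}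
    [AddCommMonoid M] [AddCommMonoid N] {d : M →+ ℕ} {e : N →+ ℕ}
    (hd : HasTrivialMonoidAlgebra k d) (he : HasTrivialMonoidAlgebra k e) :
    HasTrivialMonoidAlgebra k (d.coprod e) := by
  obtain ⟨R, _, _, A, hA, b, hb⟩ := hd
  obtain ⟨S, _, _, B, hB, c, hc⟩ := he
  exact ⟨_, _, _, _, .tensor hA hB, _, hb.tensorProduct hc⟩

/-! ### Segre products -/

section Segre

variable {M : Type v} {N : Type w} [AddCommMonoid M] [AddCommMonoid N] {d : M →+ ℕ}
  {e : N →+ ℕ}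

/-- The fibre product of two graded monoids over their degrees. -/
abbrev segreMonoid (d : M →+ ℕ) (e : N →+ ℕ) : AddSubmonoid (M × N) :=
  (d.comp (AddMonoidHom.fst M N)).eqLocusM (e.comp (AddMonoidHom.snd M N))

/-- The degree on the fibre product of two graded monoids. -/
abbrev segreDegree (d : M →+ ℕ) (e : N →+ ℕ) : segreMonoid d e →+ ℕ :=
  (d.comp (AddMonoidHom.fst M N)).comp (segreMonoid d e).subtype

/-- Distinct generators of a Segre product may agree in one coordinate. There any degree-one divisor
of `m` serves, at the price of requiring `m` to have positive degree. -/
theorem IsStronglyKoszulMonoid.exists_add_of_eq (hd : IsStandardMonoid d)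
    (kd : IsStronglyKoszulMonoid d) {a b m m' : M} (ha : d a = 1) (hb : d b = 1)
    (hm : d m ≠ 0) (h : m + a = b + m') :
    ∃ g r s, d g = 1 ∧ m = g + r ∧ g + a = b + s := by
  by_cases hab : a = b
  · subst hab
    obtain ⟨g, r, hg, hr⟩ := hd.exists_add m hm
    exact ⟨g, r, g, hg, hr, add_comm _ _⟩
  · exact kd a b m m' ha hb hab h

theorem IsStronglyKoszulMonoid.segre (hd : IsStandardMonoid d) (he : IsStandardMonoid e)
    (kd : IsStronglyKoszulMonoid d) (ke : IsStronglyKoszulMonoid e) :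
    IsStronglyKoszulMonoid (segreDegree d e) := by
  rintro ⟨⟨a, a'⟩, ha'⟩ ⟨⟨b, b'⟩, hb'⟩ ⟨⟨m, m'⟩, hm'⟩ ⟨⟨n, n'⟩, hn'⟩ ha hb hab h
  have ha' : d a = e a' := ha'
  have hb' : d b = e b' := hb'
  have hm' : d m = e m' := hm'
  have hn' : d n = e n' := hn'
  have ha : d a = 1 := ha
  have hb : d b = 1 := hb
  have h1 : m + a = b + n := congrArg (fun x => x.1.1) h
  have h2 : m' + a' = b' + n' := congrArg (fun x => x.1.2) h
  -- If `m` had degree zero, then so would `n` by comparing degrees, and the relation would collapse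
  -- to `a = b`.
  have hm : d m ≠ 0 := by
    intro h0
    have hm0 := hd.eq_zero _ h0
    have hm0' := he.eq_zero _ (hm'.symm.trans h0)
    have hn : d n = 0 := by
      have := congrArg d h1
      simp only [map_add] at this
      omega
    have hn0 := hd.eq_zero _ hn
    have hn0' := he.eq_zero _ (hn'.symm.trans hn)
    subst hm0 hm0' hn0 hn0'
    apply hab
    simp only [zero_add, add_zero] at h1 h2
    subst h1 h2
    rfl
  obtain ⟨g, r, s, hg, rfl, hs⟩ := kd.exists_add_of_eq hd ha hb hm h1
  obtain ⟨g', r', s', hg', rfl, hs'⟩ :=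
    ke.exists_add_of_eq he (ha'.symm.trans ha) (hb'.symm.trans hb) (hm' ▸ hm) h2
  refine ⟨⟨(g, g'), hg.trans hg'.symm⟩, ⟨(r, r'), ?_⟩, ⟨(s, s'), ?_⟩, hg, rfl,
    Subtype.ext (Prod.ext hs hs')⟩
  · rw [map_add, map_add, hg, hg', add_right_inj] at hm'
    exact hm'
  · have h1 := congrArg d hs
    have h2 := congrArg e hs'
    simp only [map_add] at h1 h2
    change d s = e s'
    omega

variable {k : Type u} [Field k] {R S : Type x} [CommRing R] [Algebra k R] [CommRing S]
  [Algebra k S] {A : ℕ → Submodule k R} {B : ℕ → Submodule k S}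
  {b : Module.Basis M k R} {c : Module.Basis N k S}

/-- The basis tensors of equal bidegree are closed under multiplication, so the algebra they
generate is no larger than their linear span. -/
theorem IsMonomialBasis.segreProduct_eq_span (hb : IsMonomialBasis d A b)
    (hc : IsMonomialBasis e B c) :
    Subalgebra.toSubmodule (segreProduct A B) =
      Submodule.span k (Set.range fun m : segreMonoid d e => b.tensorProduct c m) := by
  apply le_antisymm
  · let T : Submonoid (R ⊗[k] S) :=
      { carrier := Set.range fun m : segreMonoid d e => b.tensorProduct c m
        one_mem' := ⟨0, hb.tensorProduct_zero hc⟩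
        mul_mem' := by
          rintro _ _ ⟨m, rfl⟩ ⟨n, rfl⟩
          exact ⟨m + n, hb.tensorProduct_mul hc m n⟩ }
    have hT : Subalgebra.toSubmodule (Algebra.adjoin k (T : Set (R ⊗[k] S))) =
        Submodule.span k (T : Set (R ⊗[k] S)) := by
      rw [Algebra.adjoin_eq_span, Submonoid.closure_eq]
    change _ ≤ Submodule.span k (T : Set (R ⊗[k] S))
    rw [← hT]
    refine Subalgebra.toSubmodule.monotone (Algebra.adjoin_le ?_)
    rintro z ⟨n, hz⟩
    rw [hb.tensorPiece_eq_span hc] at hz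
    rw [SetLike.mem_coe, ← Subalgebra.mem_toSubmodule, hT]
    refine Submodule.span_mono ?_ hz
    rintro _ ⟨m, ⟨h1, h2⟩, rfl⟩
    exact ⟨⟨m, h1.trans h2.symm⟩, rfl⟩
  · rw [Submodule.span_le]
    rintro _ ⟨⟨m, hm⟩, rfl⟩
    refine Algebra.subset_adjoin ⟨d m.1, ?_⟩
    rw [hb.tensorPiece_eq_span hc]
    exact Submodule.subset_span ⟨m, ⟨rfl, hm.symm⟩, rfl⟩

/-- The basis of the Segre product indexed by the fibre product of the monoids. -/
noncomputable def IsMonomialBasis.segreBasis (hb : IsMonomialBasis d A b)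
    (hc : IsMonomialBasis e B c) :
    Module.Basis (segreMonoid d e) k (segreProduct A B) :=
  (Module.Basis.span ((b.tensorProduct c).linearIndependent.comp
    ((↑) : segreMonoid d e → M × N) Subtype.coe_injective)).map
    (LinearEquiv.ofEq _ _ (hb.segreProduct_eq_span hc).symm)

theorem IsMonomialBasis.coe_segreBasis (hb : IsMonomialBasis d A b)
    (hc : IsMonomialBasis e B c) (m : segreMonoid d e) :
    (hb.segreBasis hc m : R ⊗[k] S) = b.tensorProduct c m := by
  rw [segreBasis, Module.Basis.map_apply, LinearEquiv.coe_ofEq_apply, Module.Basis.span_apply]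
  rfl

theorem IsMonomialBasis.segre (hb : IsMonomialBasis d A b) (hc : IsMonomialBasis e B c) :
    IsMonomialBasis (segreDegree d e) (segreGrading A B) (hb.segreBasis hc) where
  map_zero := Subtype.ext (by
    rw [hb.coe_segreBasis hc]
    exact hb.tensorProduct_zero hc)
  map_add m n := Subtype.ext (by
    rw [Subalgebra.coe_mul]
    simp only [hb.coe_segreBasis hc]
    exact hb.tensorProduct_mul hc m n)
  grading n := by
    have himage : b.tensorProduct c '' {m | d m.1 = n ∧ e m.2 = n} =
        (segreProduct A B).val.toLinearMap '' (hb.segreBasis hc '' {m | segreDegree d e m = n}) := by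
      simp only [Set.image_image, AlgHom.toLinearMap_apply, Subalgebra.coe_val,
        hb.coe_segreBasis hc]
      ext x
      constructor
      · rintro ⟨m, ⟨h1, h2⟩, rfl⟩
        exact Set.mem_image_of_mem
          (fun m : segreMonoid d e => b.tensorProduct c (m : M × N))
          (x := ⟨m, h1.trans h2.symm⟩) h1
      · rintro ⟨m, h1, rfl⟩
        have hm : d m.1.1 = e m.1.2 := m.2
        have h1 : d m.1.1 = n := h1
        exact Set.mem_image_of_mem _ ⟨h1, hm.symm.trans h1⟩
    have hinj : Function.Injective (segreProduct A B).val.toLinearMap := Subtype.coe_injective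
    rw [segreGrading, hb.tensorPiece_eq_span hc, himage, ← Submodule.map_span,
      Submodule.comap_map_eq_of_injective hinj]

end Segre

theorem HasTrivialMonoidAlgebra.segre {k : Type u} [Field k] {M : Type v} {N : Type w}
    [AddCommMonoid M] [AddCommMonoid N] {d : M →+ ℕ} {e : N →+ ℕ}
    (hd : HasTrivialMonoidAlgebra k d) (he : HasTrivialMonoidAlgebra k e) :
    HasTrivialMonoidAlgebra k (segreDegree d e) := by
  obtain ⟨R, _, _, A, hA, b, hb⟩ := hd
  obtain ⟨S, _, _, B, hB, c, hc⟩ := he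
  exact ⟨_, _, _, _, .segre hA hB, _, hb.segre hc⟩

/-! ### Strong Koszulness of monoid algebras -/

section StronglyKoszul

variable {k : Type u} [Field k] {M : Type v} [AddCommMonoid M] {d : M →+ ℕ}
  {R : Type w} [CommRing R] [Algebra k R] {A : ℕ → Submodule k R} {b : Module.Basis M k R}

theorem IsMonomialBasis.restrictScalars_span_image (hb : IsMonomialBasis d A b) (N : Set M) :
    (Ideal.span (b '' N)).restrictScalars k =
      Submodule.span k (b '' {m | ∃ n ∈ N, ∃ r, m = n + r}) := by
  apply le_antisymm
  · intro x hx
    rw [Submodule.restrictScalars_mem] at hx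
    induction hx using Submodule.span_induction with
    | mem x hx =>
      obtain ⟨n, hn, rfl⟩ := hx
      exact Submodule.subset_span ⟨n, ⟨n, hn, 0, (add_zero n).symm⟩, rfl⟩
    | zero => exact Submodule.zero_mem _
    | add x y _ _ hx hy => exact Submodule.add_mem _ hx hy
    | smul a x _ hx =>
      rw [smul_eq_mul]
      have ha : a ∈ Submodule.span k (Set.range b) := b.mem_span a
      refine Submodule.span_induction₂
        (p := fun a x _ _ => a * x ∈ Submodule.span k (b '' {m | ∃ n ∈ N, ∃ r, m = n + r}))
        ?_ ?_ ?_ ?_ ?_ ?_ ?_ ha hx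
      · rintro _ _ ⟨m, rfl⟩ ⟨_, ⟨n, hn, r, rfl⟩, rfl⟩
        rw [← hb.map_add]
        exact Submodule.subset_span ⟨_, ⟨n, hn, m + r, add_left_comm _ _ _⟩, rfl⟩
      · intro y _
        rw [zero_mul]
        exact Submodule.zero_mem _
      · intro y _
        rw [mul_zero]
        exact Submodule.zero_mem _
      · intro y z w _ _ _ h1 h2
        rw [add_mul]
        exact Submodule.add_mem _ h1 h2
      · intro y z w _ _ _ h1 h2
        rw [mul_add]
        exact Submodule.add_mem _ h1 h2
      · intro c y z _ _ h
        rw [smul_mul_assoc]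
        exact Submodule.smul_mem _ c h
      · intro c y z _ _ h
        rw [mul_smul_comm]
        exact Submodule.smul_mem _ c h
  · rw [Submodule.span_le]
    rintro _ ⟨_, ⟨n, hn, r, rfl⟩, rfl⟩
    rw [hb.map_add]
    exact Ideal.mul_mem_right _ _ (Ideal.subset_span ⟨n, hn, rfl⟩)

theorem IsMonomialBasis.mem_ideal_span_image (hb : IsMonomialBasis d A b) {N : Set M} {x : R} :
    x ∈ Ideal.span (b '' N) ↔ ∀ m ∈ (b.repr x).support, ∃ n ∈ N, ∃ r, m = n + r := by
  rw [← Submodule.restrictScalars_mem k, hb.restrictScalars_span_image,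
    Module.Basis.mem_span_image]
  rfl

theorem IsMonomialBasis.apply_mem_ideal_span_image (hb : IsMonomialBasis d A b) {N : Set M}
    {m : M} : b m ∈ Ideal.span (b '' N) ↔ ∃ n ∈ N, ∃ r, m = n + r := by
  simp [hb.mem_ideal_span_image, Finsupp.support_single]

theorem IsMonomialBasis.repr_mul_apply (hb : IsMonomialBasis d A b) (x : R) (a : M) :
    b.repr (x * b a) = (b.repr x).mapDomain (· + a) := by
  have : b.repr.toLinearMap ∘ₗ LinearMap.mulRight k (b a) =
      Finsupp.lmapDomain k k (· + a) ∘ₗ b.repr.toLinearMap :=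
    b.ext fun m => by simp [← hb.map_add]
  exact LinearMap.congr_fun this x

/-- Translation by `a` is injective, so multiplying by `b a` shifts the support without merging
terms, and membership can be tested one monomial at a time. -/
theorem IsMonomialBasis.mem_colon [IsCancelAdd M] (hb : IsMonomialBasis d A b) {N : Set M}
    {a : M} {x : R} : x ∈ (Ideal.span (b '' N)).colon {b a} ↔
      ∀ m ∈ (b.repr x).support, ∃ n ∈ N, ∃ r, m + a = n + r := by
  classical
  rw [Submodule.mem_colon_singleton, smul_eq_mul, hb.mem_ideal_span_image, hb.repr_mul_apply,
    Finsupp.mapDomain_support_of_injective (add_left_injective a)]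
  simp

theorem IsMonomialBasis.apply_mem_colon [IsCancelAdd M] (hb : IsMonomialBasis d A b) {N : Set M}
    {a m : M} : b m ∈ (Ideal.span (b '' N)).colon {b a} ↔ ∃ n ∈ N, ∃ r, m + a = n + r := by
  rw [hb.mem_colon]
  simp [Finsupp.support_single]

theorem IsStandardMonoid.eq_of_eq_add (hd : IsStandardMonoid d) {a b r : M} (ha : d a = 1)
    (hb : d b = 1) (h : a = b + r) : a = b := by
  have h' := congrArg d h
  rw [map_add, ha, hb] at h'
  rw [h, hd.eq_zero r (by omega), add_zero]

theorem IsMonomialBasis.isStronglyKoszulWith (hb : IsMonomialBasis d A b) [IsCancelAdd M]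
    (hd : IsStandardMonoid d) (h : IsStronglyKoszulMonoid d) {t : ℕ} {g : Fin t → M}
    (hinj : Function.Injective g) (hg : Set.range g = {m | d m = 1}) :
    IsStronglyKoszulWith A fun i => b (g i) := by
  have hg1 (i) : d (g i) = 1 := hg.subset ⟨i, rfl⟩
  have hg2 (m) (hm : d m = 1) : ∃ i, g i = m := hg.superset hm
  refine ⟨fun i => ⟨1, ?_⟩, ?_, fun i hi => ?_, fun r s hs j => ?_⟩
  · rw [hb.grading]
    exact Submodule.subset_span ⟨g i, hg1 i, rfl⟩
  · apply le_antisymm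
    · rw [Ideal.span_le]
      rintro _ ⟨i, rfl⟩
      refine Ideal.subset_span ⟨1, one_pos, ?_⟩
      rw [hb.grading]
      exact Submodule.subset_span ⟨g i, hg1 i, rfl⟩
    · refine Ideal.span_le.2 ?_
      rintro x ⟨n, hn, hx⟩
      rw [hb.grading, Module.Basis.mem_span_image] at hx
      rw [SetLike.mem_coe, show (Set.range fun i => b (g i)) = b '' Set.range g from
        Set.range_comp b g, hb.mem_ideal_span_image]
      intro m hm
      have : d m = n := hx hm
      obtain ⟨p, r, hp, hr⟩ := hd.exists_add m (by omega)
      exact ⟨p, hg2 p hp, r, hr⟩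
  · rw [← Set.image_image b g, hb.apply_mem_ideal_span_image] at hi
    obtain ⟨_, ⟨j, hj, rfl⟩, r, hr⟩ := hi
    exact hj (hinj (hd.eq_of_eq_add (hg1 i) (hg1 j) hr)).symm
  -- The generators that themselves lie in the colon ideal. Each monomial of the ideal is caught by
  -- a single earlier `g (s l)`, and the monoid condition for that pair supplies a degree-one
  -- divisor from this set.
  · refine ⟨{i | ∃ l < j, ∃ r, g i + g (s j) = g (s l) + r}, ?_⟩
    ext x
    rw [← Set.image_image b (fun l => g (s l)), ← Set.image_image b g, hb.mem_colon,
      hb.mem_ideal_span_image]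
    refine forall₂_congr fun m _ => ⟨?_, ?_⟩
    · rintro ⟨_, ⟨l, hl, rfl⟩, r, hr⟩
      obtain ⟨p, q, z, hp, hq, hz⟩ := h _ _ _ _ (hg1 (s j)) (hg1 (s l))
        (fun h => (hs hl).ne' (hinj h)) hr
      obtain ⟨i, rfl⟩ := hg2 p hp
      exact ⟨g i, ⟨i, ⟨l, hl, z, hz⟩, rfl⟩, q, hq⟩
    · rintro ⟨_, ⟨i, ⟨l, hl, z, hz⟩, rfl⟩, r, rfl⟩
      exact ⟨_, ⟨l, hl, rfl⟩, z + r, by rw [add_right_comm, hz, add_assoc]⟩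

theorem IsMonomialBasis.isStronglyKoszulMonoid (hb : IsMonomialBasis d A b) [IsCancelAdd M]
    {t : ℕ} {g : Fin t → M} (hg : Set.range g = {m | d m = 1})
    (h : IsStronglyKoszulWith A fun i => b (g i)) : IsStronglyKoszulMonoid d := by
  have hg1 (i) : d (g i) = 1 := hg.subset ⟨i, rfl⟩
  have hg2 (m) (hm : d m = 1) : ∃ i, g i = m := hg.superset hm
  have key {i j : Fin t} (hij : i < j) {m m' : M} (hm : m + g j = g i + m') :
      ∃ p r s, d p = 1 ∧ m = p + r ∧ p + g j = g i + s := by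
    -- Only subsequences of length two are needed: the colon is `(g i) : g j`.
    obtain ⟨B, hB⟩ := h.colon 2 ![i, j]
      (by rw [Fin.strictMono_iff_lt_succ]; simpa using hij) 1
    have hI : (fun l => b (g (![i, j] l))) '' Set.Iio 1 = b '' {g i} := by
      ext x
      simp [eq_comm]
    rw [hI, ← Set.image_image b g] at hB
    simp only [Matrix.cons_val_one, Matrix.cons_val_fin_one] at hB
    have hmem : b m ∈ (Ideal.span (b '' {g i})).colon {b (g j)} :=
      hb.apply_mem_colon.2 ⟨g i, rfl, m', hm⟩
    rw [hB, hb.apply_mem_ideal_span_image] at hmem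
    obtain ⟨_, ⟨l, hl, rfl⟩, r, hr⟩ := hmem
    have hmem' : b (g l) ∈ (Ideal.span (b '' {g i})).colon {b (g j)} := by
      rw [hB]
      exact Ideal.subset_span ⟨g l, ⟨l, hl, rfl⟩, rfl⟩
    obtain ⟨_, rfl, s, hs⟩ := hb.apply_mem_colon.1 hmem'
    exact ⟨g l, r, s, hg1 l, hr, hs⟩
  intro a c m m' ha hc hac hm
  obtain ⟨j, rfl⟩ := hg2 a ha
  obtain ⟨i, rfl⟩ := hg2 c hc
  rcases lt_trichotomy i j with hij | rfl | hij
  · exact key hij hm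
  · exact absurd rfl hac
  -- The sequence provides the colon only with the earlier generator inside. For the opposite order
  -- the relation is read backwards: `m'` is divided instead of `m`, and the complementary factor
  -- `s` is, after cancellation, the divisor of `m`.
  · obtain ⟨p, r, s, hp, rfl, hs⟩ := key hij (m := m') (m' := m)
      (by rw [add_comm m', ← hm, add_comm])
    refine ⟨s, r, p, ?_, ?_, by rw [add_comm s, ← hs, add_comm]⟩
    · have := congrArg d hs
      rw [d.map_add, d.map_add, ha, hc, hp] at this
      omega
    · apply add_right_cancel (b := g j)
      rw [hm, ← add_assoc, add_comm (g i), hs, add_comm (g j), add_right_comm]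

end StronglyKoszul

/-! ### Graphs without induced `C₄` and `P₄` -/

section Graph

variable {V : Type v} {G : SimpleGraph V}

/-- Every path `x, a, b, y` in `G` with `x ≠ b` and `a ≠ y` has one of the chords `xb`, `ay`. -/
def HasShortChords (G : SimpleGraph V) : Prop :=
  ∀ x a b y, G.Adj x a → G.Adj a b → G.Adj b y → x ≠ b → a ≠ y → G.Adj x b ∨ G.Adj a y

/-- A chordless walk `x, a, b, y` induces `C₄` or `P₄` according to whether `x` and `y` are
adjacent; `x = y` is impossible because `x` is adjacent to `a` and `y` is not. -/
theorem hasShortChords_iff : HasShortChords G ↔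
    ¬ (SimpleGraph.cycleGraph 4).IsIndContained G ∧
      ¬ (SimpleGraph.pathGraph 4).IsIndContained G := by
  have path_adj (i j : Fin 4) : (SimpleGraph.pathGraph 4).Adj i j ↔
      i.val + 1 = j.val ∨ j.val + 1 = i.val := SimpleGraph.pathGraph_adj
  have cycle_adj (i j : Fin 4) : (SimpleGraph.cycleGraph 4).Adj i j ↔
      i - j = 1 ∨ j - i = 1 := SimpleGraph.cycleGraph_adj
  constructor
  · intro h
    refine ⟨fun ⟨f⟩ => ?_, fun ⟨f⟩ => ?_⟩
    · rcases h (f 0) (f 1) (f 2) (f 3) (by simp [cycle_adj]) (by simp [cycle_adj])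
        (by simp [cycle_adj]) (by simp) (by simp) with h | h <;>
        rw [f.map_adj_iff, cycle_adj] at h <;> revert h <;> decide
    · rcases h (f 0) (f 1) (f 2) (f 3) (by simp [path_adj]) (by simp [path_adj])
        (by simp [path_adj]) (by simp) (by simp) with h | h <;>
        rw [f.map_adj_iff, path_adj] at h <;> revert h <;> decide
  · rintro ⟨hC, hP⟩ x a b y hxa hab hby hxb hay
    by_contra! hne
    obtain ⟨h1, h2⟩ := hne
    have hxy : x ≠ y := by
      rintro rfl
      exact h2 hxa.symm
    have hinj : Function.Injective ![x, a, b, y] := by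
      intro i j hij
      fin_cases i <;> fin_cases j <;>
        simp_all [hxa.ne, hxa.ne', hab.ne, hab.ne', hby.ne, hby.ne', hxb.symm, hay.symm, hxy.symm]
    by_cases hadj : G.Adj x y
    · refine hC ⟨⟨⟨_, hinj⟩, ?_⟩⟩
      intro i j
      rw [cycle_adj]
      fin_cases i <;> fin_cases j <;>
        simp [hxa, hab, hby, hxa.symm, hab.symm, hby.symm, h1, h2, hadj, hadj.symm,
          G.adj_comm b x, G.adj_comm y a] <;> decide
    · refine hP ⟨⟨⟨_, hinj⟩, ?_⟩⟩
      intro i j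
      rw [path_adj]
      fin_cases i <;> fin_cases j <;>
        simp [hxa, hab, hby, hxa.symm, hab.symm, hby.symm, h1, h2, hadj,
          G.adj_comm b x, G.adj_comm y a, G.adj_comm y x]

/-- The closed neighbourhood of a vertex. -/
def closedNbhd (G : SimpleGraph V) (a : V) : Set V := insert a (G.neighborSet a)

theorem mem_closedNbhd {a b : V} : b ∈ closedNbhd G a ↔ b = a ∨ G.Adj a b := Iff.rfl

theorem self_mem_closedNbhd (a : V) : a ∈ closedNbhd G a := Or.inl rfl

/-- If neither inclusion holds, a private neighbour `x` of `a` and a private neighbour `y` of `b`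
give a walk `x, a, b, y` without chords. -/
theorem HasShortChords.closedNbhd_subset_or (h : HasShortChords G) {a b : V}
    (hab : b ∈ closedNbhd G a) :
    closedNbhd G a ⊆ closedNbhd G b ∨ closedNbhd G b ⊆ closedNbhd G a := by
  rcases hab with rfl | hab
  · exact .inl subset_rfl
  have hab : G.Adj a b := hab
  by_contra! hne
  obtain ⟨h1, h2⟩ := hne
  obtain ⟨x, hx, hx'⟩ := Set.not_subset.1 h1
  obtain ⟨y, hy, hy'⟩ := Set.not_subset.1 h2
  rw [mem_closedNbhd] at hx hx' hy hy'
  push Not at hx' hy'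
  have hxa : G.Adj a x := hx.resolve_left fun h => hx'.2 (h ▸ hab.symm)
  have hyb : G.Adj b y := hy.resolve_left fun h => hy'.2 (h ▸ hab)
  rcases h x a b y hxa.symm hab hyb hx'.1 hy'.1.symm with h | h
  · exact hx'.2 h.symm
  · exact hy'.2 h

theorem HasShortChords.induce (h : HasShortChords G) (W : Set V) :
    HasShortChords (G.induce W) :=
  fun x a b y hxa hab hby hxb hay => h x a b y hxa hab hby
    (fun h => hxb (Subtype.ext h)) (fun h => hay (Subtype.ext h))

theorem exists_maximal_clique [Finite V] {C : Set V} (hC : G.IsClique C) :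
    ∃ D, C ⊆ D ∧ Maximal (fun D : Set V => G.IsClique D) D :=
  (Set.toFinite {D : Set V | G.IsClique D}).exists_le_maximal hC

/-- Extend each vertex of a largest stable set to a maximal clique; a clique contains at most one of
these vertices. -/
theorem indepNum_le_numMaximalCliques [Finite V] : G.indepNum ≤ numMaximalCliques G := by
  obtain ⟨s, hs⟩ := G.exists_isNIndepSet_indepNum
  choose f hf hmax using fun a : V =>
    exists_maximal_clique (G := G) (C := {a}) (Set.pairwise_singleton _ _)
  have hinj : Set.InjOn f s := by
    intro a ha b hb hab
    by_contra hne
    exact hs.isIndepSet ha hb hne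
      ((hmax a).1 (hf a rfl) (hab ▸ hf b rfl) hne)
  rw [← hs.card_eq, ← Set.ncard_coe_finset, ← hinj.ncard_image]
  refine Set.ncard_le_ncard ?_ (Set.toFinite _)
  rintro _ ⟨a, _, rfl⟩
  exact hmax a

theorem HasShortChords.exists_closedNbhd_eq [Finite V] [Nonempty V] (h : HasShortChords G)
    {C : Set V} (hC : Maximal (fun D : Set V => G.IsClique D) C) :
    ∃ a, closedNbhd G a = C := by
  -- This is where a vertex is needed: with no vertices, the empty clique is maximal and is no
  -- closed neighbourhood.
  have hne : C.Nonempty := by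
    rw [Set.nonempty_iff_ne_empty]
    rintro rfl
    obtain ⟨a⟩ := ‹Nonempty V›
    exact hC.2 (Set.pairwise_singleton a _) (Set.empty_subset _) rfl
  obtain ⟨a, ha, hmin⟩ :=
    Set.exists_min_image C (fun a => (closedNbhd G a).ncard) (Set.toFinite _) hne
  have hsub : ∀ b ∈ C, closedNbhd G a ⊆ closedNbhd G b := by
    intro b hb
    have hab : b ∈ closedNbhd G a := by
      by_cases hab : b = a
      · exact .inl hab
      · exact .inr (hC.1 ha hb (Ne.symm hab))
    -- If the comparison goes the wrong way, minimality of the cardinality forces equality.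
    refine (h.closedNbhd_subset_or hab).elim id fun hba => ?_
    exact (Set.eq_of_subset_of_ncard_le hba (hmin b hb) (Set.toFinite _)).ge
  refine ⟨a, subset_antisymm (fun c hc => ?_) fun b hb => ?_⟩
  -- A point `c` of the smallest closed neighbourhood lies in that of every vertex of `C`, so it can
  -- be added to the clique.
  · refine hC.2 (y := insert c C) ?_ (Set.subset_insert _ _) (Set.mem_insert _ _)
    refine SimpleGraph.IsClique.insert hC.1 fun b hb hcb => ?_
    exact ((hsub b hb hc).resolve_left hcb).symm
  · by_cases hab : b = a
    · exact .inl hab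
    · exact .inr (hC.1 ha hb (Ne.symm hab))

/-- Pick for each maximal clique a vertex whose closed neighbourhood is that clique. If the vertices
picked for `C` and `D` are adjacent, then `f D ∈ C`, hence `C ⊆ D` and `C = D`; so the picked
vertices form a stable set. -/
theorem HasShortChords.indepNum_eq [Finite V] [Nonempty V] (h : HasShortChords G) :
    G.indepNum = numMaximalCliques G := by
  classical
  refine le_antisymm indepNum_le_numMaximalCliques ?_
  have := Fintype.ofFinite V
  choose! f hf using fun (C : Set V) (hC : C ∈ {C | Maximal (fun D => G.IsClique D) C}) =>
    h.exists_closedNbhd_eq hC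
  have hinj : Set.InjOn f {C | Maximal (fun D => G.IsClique D) C} := by
    intro C hC D hD hCD
    rw [← hf C hC, ← hf D hD, hCD]
  rw [numMaximalCliques, ← hinj.ncard_image, Set.ncard_eq_toFinset_card']
  refine SimpleGraph.IsIndepSet.card_le_indepNum ?_
  rw [Set.coe_toFinset]
  rintro _ ⟨C, hC, rfl⟩ _ ⟨D, hD, rfl⟩ hne hadj
  refine hne ?_
  have hDC : f D ∈ C := (hf C hC) ▸ Or.inr hadj
  have : C ⊆ D := by
    intro b hb
    rw [← hf D hD]
    by_cases hbD : b = f D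
    · exact .inl hbD
    · exact .inr (hC.1 hDC hb (Ne.symm hbD))
  rw [hC.eq_of_subset hD.1 this]

/-- A chordless walk `x, a, b, y` spans a graph covered by the two cliques `{x, a}` and `{b, y}`, so
stable sets have at most two elements, while its three edges lie in three different maximal cliques.
-/
theorem isTriviallyPerfect_iff_hasShortChords [Finite V] :
    IsTriviallyPerfect G ↔ HasShortChords G := by
  constructor
  · intro h x a b y hxa hab hby hxb hay
    by_contra! hne
    obtain ⟨h1, h2⟩ := hne
    let W : Set V := {x, a, b, y}
    have hW := h W ⟨x, .inl rfl⟩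
    let x' : W := ⟨x, by simp [W]⟩
    let a' : W := ⟨a, by simp [W]⟩
    let b' : W := ⟨b, by simp [W]⟩
    let y' : W := ⟨y, by simp [W]⟩
    have hle : (G.induce W).indepNum ≤ 2 := by
      classical
      obtain ⟨s, hs⟩ := (G.induce W).exists_isNIndepSet_indepNum
      -- A stable set injects into `Bool` by recording which of the cliques `{x, a}`, `{b, y}` a
      -- vertex belongs to.
      rw [← hs.card_eq, ← Fintype.card_bool, ← Finset.card_univ]
      refine Finset.card_le_card_of_injOn (fun c => decide (c = x' ∨ c = a'))
        (fun _ _ => Finset.mem_univ _) ?_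
      intro c hc e he hce
      by_contra hne
      have hadj := hs.isIndepSet hc he hne
      simp only [SimpleGraph.comap_adj, Function.Embedding.subtype_apply] at hadj
      obtain ⟨c, hcW⟩ := c
      obtain ⟨e, heW⟩ := e
      simp only [decide_eq_decide, Subtype.mk.injEq, x', a'] at hce hne
      have hbx : b ≠ x := hxb.symm
      have hba : b ≠ a := hab.ne'
      have hya : y ≠ a := hay.symm
      have hyx : y ≠ x := by
        rintro rfl
        exact h2 hxa.symm
      rcases hcW with rfl | rfl | rfl | rfl <;> rcases heW with rfl | rfl | rfl | rfl <;>
        simp_all [G.adj_comm]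
    have edge {c e : W} (hce : (G.induce W).Adj c e) : (G.induce W).IsClique {c, e} :=
      SimpleGraph.isClique_pair.2 fun _ => hce
    obtain ⟨C, hC, hCm⟩ := exists_maximal_clique (edge (c := x') (e := a') hxa)
    obtain ⟨D, hD, hDm⟩ := exists_maximal_clique (edge (c := a') (e := b') hab)
    obtain ⟨E, hE, hEm⟩ := exists_maximal_clique (edge (c := b') (e := y') hby)
    have hnot {F : Set W} (hF : (G.induce W).IsClique F) {c e : W} (hc : c ∈ F) (he : e ∈ F)
        (hce : (c : V) ≠ e) : G.Adj c e := hF hc he fun h => hce (congrArg _ h)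
    have hCD : C ≠ D := by
      rintro rfl
      exact h1 (hnot hCm.1 (hC (.inl rfl)) (hD (.inr rfl)) hxb)
    have hDE : D ≠ E := by
      rintro rfl
      exact h2 (hnot hDm.1 (hD (.inl rfl)) (hE (.inr rfl)) hay)
    have hCE : C ≠ E := by
      rintro rfl
      exact h2 (hnot hCm.1 (hC (.inr rfl)) (hE (.inr rfl)) hay)
    have hthree : 3 ≤ numMaximalCliques (G.induce W) := by
      rw [← Set.ncard_eq_three.2 ⟨C, D, E, hCD, hCE, hDE, rfl⟩]
      refine Set.ncard_le_ncard ?_ (Set.toFinite _)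
      rintro _ (rfl | rfl | rfl)
      exacts [hCm, hDm, hEm]
    omega
  · intro h W hW
    have := hW.to_subtype
    exact (h.induce W).indepNum_eq

end Graph

/-! ### The monoid of the stable set polytope -/

section StableMonoid

variable {V : Type v} [Finite V] {G : SimpleGraph V}

open Classical in
/-- The exponent of the monomial `T · ∏_{i ∈ S} X_i`. -/
noncomputable def stableExponent (S : Set V) : Option V →₀ ℕ :=
  Finsupp.equivFunOnFinite.symm fun o => o.elim 1 fun i => if i ∈ S then 1 else 0

@[simp]
theorem stableExponent_none (S : Set V) : stableExponent S none = 1 := rfl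

open Classical in
theorem stableExponent_some (S : Set V) (i : V) :
    stableExponent S (some i) = if i ∈ S then 1 else 0 := rfl

theorem stableExponent_injective : Function.Injective (stableExponent (V := V)) := by
  classical
  intro S T h
  ext i
  have := DFunLike.congr_fun h (some i)
  simp only [stableExponent_some] at this
  by_cases hS : i ∈ S <;> by_cases hT : i ∈ T <;> simp_all

/-- The monoid generated by the exponents of the stable sets contained in `W`. -/
noncomputable def stableMonoid (G : SimpleGraph V) (W : Set V) : AddSubmonoid (Option V →₀ ℕ) :=
  AddSubmonoid.closure (stableExponent '' {S | S ⊆ W ∧ G.IsIndepSet S})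

/-- The degree of an element of `stableMonoid G W` is the exponent of `T`. -/
noncomputable def stableDegree (G : SimpleGraph V) (W : Set V) : stableMonoid G W →+ ℕ :=
  (Finsupp.applyAddHom none).comp (stableMonoid G W).subtype

theorem stableDegree_apply {W : Set V} (m : stableMonoid G W) :
    stableDegree G W m = (m : Option V →₀ ℕ) none := rfl

theorem stableExponent_mem {S W : Set V} (hSW : S ⊆ W) (hS : G.IsIndepSet S) :
    stableExponent S ∈ stableMonoid G W :=
  AddSubmonoid.subset_closure ⟨S, ⟨hSW, hS⟩, rfl⟩

theorem stableMonoid_mono {W W' : Set V} (h : W ⊆ W') : stableMonoid G W ≤ stableMonoid G W' :=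
  AddSubmonoid.closure_mono (Set.image_mono fun _ hS => ⟨hS.1.trans h, hS.2⟩)

theorem eq_zero_or_exists_of_mem_stableMonoid {W : Set V} {m : Option V →₀ ℕ}
    (hm : m ∈ stableMonoid G W) : m = 0 ∨
      ∃ S ⊆ W, G.IsIndepSet S ∧ ∃ r ∈ stableMonoid G W, m = stableExponent S + r := by
  induction hm using AddSubmonoid.closure_induction with
  | mem m hm =>
    obtain ⟨S, ⟨hSW, hS⟩, rfl⟩ := hm
    exact .inr ⟨S, hSW, hS, 0, zero_mem _, (add_zero _).symm⟩
  | zero => exact .inl rfl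
  | add m n hm hn hm' hn' =>
    rcases hm' with rfl | ⟨S, hSW, hS, r, hr, rfl⟩
    · rwa [zero_add]
    · exact .inr ⟨S, hSW, hS, r + n, add_mem hr hn, add_assoc _ _ _⟩

theorem exists_of_mem_stableMonoid {W : Set V} {m : Option V →₀ ℕ} {n : ℕ}
    (hm : m ∈ stableMonoid G W) (hn : m none = n + 1) :
    ∃ S ⊆ W, G.IsIndepSet S ∧ ∃ r ∈ stableMonoid G W,
      r none = n ∧ m = stableExponent S + r := by
  rcases eq_zero_or_exists_of_mem_stableMonoid hm with rfl | ⟨S, hSW, hS, r, hr, rfl⟩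
  · simp at hn
  · refine ⟨S, hSW, hS, r, hr, ?_, rfl⟩
    rw [Finsupp.add_apply, stableExponent_none] at hn
    omega

theorem eq_zero_of_mem_stableMonoid {W : Set V} {m : Option V →₀ ℕ}
    (hm : m ∈ stableMonoid G W) (hn : m none = 0) : m = 0 := by
  rcases eq_zero_or_exists_of_mem_stableMonoid hm with rfl | ⟨S, hSW, hS, r, hr, rfl⟩
  · rfl
  · rw [Finsupp.add_apply, stableExponent_none] at hn
    omega

theorem exists_eq_stableExponent {W : Set V} {m : Option V →₀ ℕ}
    (hm : m ∈ stableMonoid G W) (hn : m none = 1) :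
    ∃ S ⊆ W, G.IsIndepSet S ∧ m = stableExponent S := by
  obtain ⟨S, hSW, hS, r, hr, hr0, rfl⟩ := exists_of_mem_stableMonoid hm hn
  exact ⟨S, hSW, hS, by rw [eq_zero_of_mem_stableMonoid hr hr0, add_zero]⟩

theorem apply_some_eq_zero_of_mem_stableMonoid {W : Set V} {m : Option V →₀ ℕ}
    (hm : m ∈ stableMonoid G W) {i : V} (hi : i ∉ W) : m (some i) = 0 := by
  induction hm using AddSubmonoid.closure_induction with
  | mem m hm =>
    obtain ⟨S, ⟨hSW, hS⟩, rfl⟩ := hm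
    rw [stableExponent_some, if_neg fun h => hi (hSW h)]
  | zero => rfl
  | add m n _ _ hm hn => rw [Finsupp.add_apply, hm, hn]

theorem isStandardMonoid_stableDegree (G : SimpleGraph V) (W : Set V) :
    IsStandardMonoid (stableDegree G W) where
  eq_zero m hm := Subtype.ext (eq_zero_of_mem_stableMonoid m.2 hm)
  exists_add m hm := by
    obtain ⟨n, hn⟩ := Nat.exists_eq_succ_of_ne_zero hm
    obtain ⟨S, hSW, hS, r, hr, -, h⟩ := exists_of_mem_stableMonoid m.2 hn
    exact ⟨⟨_, stableExponent_mem hSW hS⟩, ⟨r, hr⟩, rfl, Subtype.ext h⟩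

theorem exists_equiv_stableMonoid_empty (G : SimpleGraph V) :
    ∃ e : ℕ ≃+ stableMonoid G ∅, ∀ n, stableDegree G ∅ (e n) = n := by
  have h0 : stableExponent ∅ ∈ stableMonoid G ∅ :=
    stableExponent_mem subset_rfl (Set.pairwise_empty _)
  let f : ℕ →+ stableMonoid G ∅ := multiplesHom _ ⟨_, h0⟩
  have hf (n : ℕ) : stableDegree G ∅ (f n) = n := by
    simp [f, stableDegree_apply]
  refine ⟨AddEquiv.ofBijective f ⟨Function.LeftInverse.injective hf, ?_⟩, hf⟩
  rintro ⟨m, hm⟩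
  have hset : {S : Set V | S ⊆ ∅ ∧ G.IsIndepSet S} = {∅} := by
    ext S
    simp only [Set.subset_empty_iff, Set.mem_ofPred_eq, Set.mem_singleton_iff,
      and_iff_left_iff_imp]
    rintro rfl
    exact Set.pairwise_empty _
  have hm' := hm
  rw [stableMonoid, hset, Set.image_singleton, AddSubmonoid.mem_closure_singleton] at hm'
  obtain ⟨n, rfl⟩ := hm'
  exact ⟨n, Subtype.ext (by simp [f])⟩

/-- The only stable set through a dominating vertex `a` is `{a}`. The exponent of `X_a` therefore
counts how often it is used, and nothing else interacts with it. -/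
theorem exists_equiv_stableMonoid_insert {W : Set V} {a : V} (ha : a ∉ W)
    (hadj : ∀ i ∈ W, G.Adj a i) :
    ∃ e : (stableMonoid G W × ℕ) ≃+ stableMonoid G (insert a W),
      ∀ m, stableDegree G (insert a W) (e m) =
        (stableDegree G W).coprod (AddMonoidHom.id ℕ) m := by
  classical
  have ha' : stableExponent {a} ∈ stableMonoid G (insert a W) :=
    stableExponent_mem (by simp) (Set.pairwise_singleton _ _)
  let f : (stableMonoid G W × ℕ) →+ stableMonoid G (insert a W) :=
    (AddSubmonoid.inclusion (stableMonoid_mono (Set.subset_insert a W))).coprod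
      (multiplesHom _ ⟨_, ha'⟩)
  have hf (m : stableMonoid G W × ℕ) :
      (f m : Option V →₀ ℕ) = (m.1 : Option V →₀ ℕ) + m.2 • stableExponent {a} := by
    simp [f]
  have hdeg (m) : stableDegree G (insert a W) (f m) =
      (stableDegree G W).coprod (AddMonoidHom.id ℕ) m := by
    simp [stableDegree_apply, hf]
  refine ⟨AddEquiv.ofBijective f ⟨?_, ?_⟩, hdeg⟩
  · rintro ⟨m, i⟩ ⟨n, j⟩ h
    have h' := congrArg Subtype.val h
    rw [hf, hf] at h'
    have hij : i = j := by
      have := DFunLike.congr_fun h' (some a)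
      simpa [stableExponent_some, apply_some_eq_zero_of_mem_stableMonoid m.2 ha,
        apply_some_eq_zero_of_mem_stableMonoid n.2 ha] using this
    subst hij
    rw [Prod.mk.injEq]
    exact ⟨Subtype.ext (add_right_cancel h'), rfl⟩
  · have hrange : ∀ m ∈ stableMonoid G (insert a W), ∃ x, (f x : Option V →₀ ℕ) = m := by
      intro m hm
      induction hm using AddSubmonoid.closure_induction with
      | mem m hm =>
        obtain ⟨S, ⟨hSW, hS⟩, rfl⟩ := hm
        by_cases haS : a ∈ S
        · have : S = {a} := by
            refine subset_antisymm (fun i hi => ?_) (by simpa using haS)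
            by_contra hne
            exact hS haS hi (Ne.symm hne) (hadj i ((hSW hi).resolve_left hne))
          subst this
          exact ⟨(0, 1), by simp [hf]⟩
        · refine ⟨(⟨_, stableExponent_mem ((Set.subset_insert_iff_of_notMem haS).1 hSW) hS⟩, 0), ?_⟩
          simp [hf]
      | zero => exact ⟨0, by simp⟩
      | add m n _ _ hm hn =>
        obtain ⟨x, rfl⟩ := hm
        obtain ⟨y, rfl⟩ := hn
        exact ⟨x + y, by simp⟩
    intro m
    obtain ⟨x, hx⟩ := hrange m m.2
    exact ⟨x, Subtype.ext hx⟩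

/-- Without edges between `A` and `B`, a stable set of the union is a free choice of one stable set
on each side. Both choices share one factor `T`, hence the fibre product over the degree. -/
theorem exists_equiv_stableMonoid_union {A B : Set V} (hdisj : Disjoint A B)
    (hadj : ∀ i ∈ A, ∀ j ∈ B, ¬ G.Adj i j) :
    ∃ e : segreMonoid (stableDegree G A) (stableDegree G B) ≃+ stableMonoid G (A ∪ B),
      ∀ m, stableDegree G (A ∪ B) (e m) =
        segreDegree (stableDegree G A) (stableDegree G B) m := by
  classical
  let p : Option V → Prop := fun o => o ≠ none
  -- `F` erases the exponent of `T`, so that `a + F b` counts the common degree once.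
  let F : (Option V →₀ ℕ) →+ (Option V →₀ ℕ) := Finsupp.filterAddHom p
  have hFnone (m : Option V →₀ ℕ) : F m none = 0 := by simp [F, p, Finsupp.filterAddHom]
  have hFsome (m : Option V →₀ ℕ) (i : V) : F m (some i) = m (some i) := by
    simp [F, p, Finsupp.filterAddHom]
  have hST {S T : Set V} (hS : S ⊆ A) (hT : T ⊆ B) :
      stableExponent S + F (stableExponent T) = stableExponent (S ∪ T) := by
    ext o
    cases o with
    | none => simp [hFnone]
    | some i =>
      rw [Finsupp.add_apply, hFsome]
      have : ¬ (i ∈ S ∧ i ∈ T) := fun h => hdisj.le_bot ⟨hS h.1, hT h.2⟩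
      by_cases h1 : i ∈ S <;> by_cases h2 : i ∈ T <;> simp_all [stableExponent_some]
  -- Equal degrees allow one stable set to be peeled off on each side simultaneously; their union is
  -- one generator of the target.
  have hmem (n : ℕ) : ∀ a ∈ stableMonoid G A, ∀ b ∈ stableMonoid G B, a none = n → b none = n →
      a + F b ∈ stableMonoid G (A ∪ B) := by
    induction n with
    | zero =>
      intro a ha b hb ha0 hb0
      rw [eq_zero_of_mem_stableMonoid ha ha0, eq_zero_of_mem_stableMonoid hb hb0]
      simp
    | succ n ih =>
      intro a ha b hb ha0 hb0
      obtain ⟨S, hSA, hS, r, hr, hr0, rfl⟩ := exists_of_mem_stableMonoid ha ha0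
      obtain ⟨T, hTB, hT, s, hs, hs0, rfl⟩ := exists_of_mem_stableMonoid hb hb0
      rw [F.map_add, add_add_add_comm, hST hSA hTB]
      refine add_mem (stableExponent_mem (Set.union_subset_union hSA hTB) ?_)
        (ih r hr s hs hr0 hs0)
      rintro i (hi | hi) j (hj | hj) hij
      · exact hS hi hj hij
      · exact hadj i (hSA hi) j (hTB hj)
      · exact fun h => hadj j (hSA hj) i (hTB hi) h.symm
      · exact hT hi hj hij
  let f₀ : segreMonoid (stableDegree G A) (stableDegree G B) →+ (Option V →₀ ℕ) :=
    ((stableMonoid G A).subtype.coprod (F.comp (stableMonoid G B).subtype)).comp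
      (segreMonoid (stableDegree G A) (stableDegree G B)).subtype
  have hf₀ (m) : f₀ m = (m.1.1 : Option V →₀ ℕ) + F m.1.2 := rfl
  let f : segreMonoid (stableDegree G A) (stableDegree G B) →+ stableMonoid G (A ∪ B) :=
    f₀.codRestrict _ fun m => hmem _ _ m.1.1.2 _ m.1.2.2 rfl (Eq.symm m.2)
  have hf (m) : (f m : Option V →₀ ℕ) = (m.1.1 : Option V →₀ ℕ) + F m.1.2 := rfl
  have hdeg (m) : stableDegree G (A ∪ B) (f m) =
      segreDegree (stableDegree G A) (stableDegree G B) m := by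
    rw [stableDegree_apply, hf, Finsupp.add_apply, hFnone, add_zero]
    rfl
  refine ⟨AddEquiv.ofBijective f ⟨?_, ?_⟩, hdeg⟩
  · rintro ⟨⟨a, b⟩, hab⟩ ⟨⟨a', b'⟩, hab'⟩ h
    have h' := congrArg Subtype.val h
    rw [hf, hf] at h'
    simp only at h'
    have hnone : (a : Option V →₀ ℕ) none = (a' : Option V →₀ ℕ) none := by
      simpa [hFnone] using DFunLike.congr_fun h' none
    have hab : (a : Option V →₀ ℕ) none = (b : Option V →₀ ℕ) none := hab
    have hab' : (a' : Option V →₀ ℕ) none = (b' : Option V →₀ ℕ) none := hab'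
    have hsome (i : V) : (a : Option V →₀ ℕ) (some i) + (b : Option V →₀ ℕ) (some i) =
        (a' : Option V →₀ ℕ) (some i) + (b' : Option V →₀ ℕ) (some i) := by
      simpa [hFsome] using DFunLike.congr_fun h' (some i)
    have hA (i : V) (hi : i ∉ A) := apply_some_eq_zero_of_mem_stableMonoid a.2 hi
    have hA' (i : V) (hi : i ∉ A) := apply_some_eq_zero_of_mem_stableMonoid a'.2 hi
    have hB (i : V) (hi : i ∉ B) := apply_some_eq_zero_of_mem_stableMonoid b.2 hi
    have hB' (i : V) (hi : i ∉ B) := apply_some_eq_zero_of_mem_stableMonoid b'.2 hi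
    have hcases (i : V) : (a : Option V →₀ ℕ) (some i) = (a' : Option V →₀ ℕ) (some i) ∧
        (b : Option V →₀ ℕ) (some i) = (b' : Option V →₀ ℕ) (some i) := by
      have hs := hsome i
      by_cases hiA : i ∈ A
      · have hiB : i ∉ B := fun h => hdisj.le_bot ⟨hiA, h⟩
        rw [hB i hiB, hB' i hiB] at hs ⊢
        exact ⟨hs, rfl⟩
      · rw [hA i hiA, hA' i hiA, zero_add, zero_add] at hs
        exact ⟨(hA i hiA).trans (hA' i hiA).symm, hs⟩
    have h1 : a = a' := Subtype.ext (Finsupp.ext fun o => by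
      cases o with
      | none => exact hnone
      | some i => exact (hcases i).1)
    have h2 : b = b' := Subtype.ext (Finsupp.ext fun o => by
      cases o with
      | none => exact hab.symm.trans (hnone.trans hab')
      | some i => exact (hcases i).2)
    subst h1 h2
    rfl
  · have hrange : ∀ m ∈ stableMonoid G (A ∪ B), ∃ x, (f x : Option V →₀ ℕ) = m := by
      intro m hm
      induction hm using AddSubmonoid.closure_induction with
      | mem m hm =>
        obtain ⟨S, ⟨hSW, hS⟩, rfl⟩ := hm
        refine ⟨⟨(⟨stableExponent (S ∩ A), stableExponent_mem Set.inter_subset_right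
          (hS.mono Set.inter_subset_left)⟩, ⟨stableExponent (S ∩ B),
          stableExponent_mem Set.inter_subset_right (hS.mono Set.inter_subset_left)⟩), rfl⟩, ?_⟩
        rw [hf]
        simp only
        rw [hST Set.inter_subset_right Set.inter_subset_right, ← Set.inter_union_distrib_left,
          Set.inter_eq_left.2 hSW]
      | zero => exact ⟨0, by simp⟩
      | add m n _ _ hm hn =>
        obtain ⟨x, rfl⟩ := hm
        obtain ⟨y, rfl⟩ := hn
        exact ⟨x + y, by simp⟩
    intro m
    obtain ⟨x, hx⟩ := hrange m m.2
    exact ⟨x, Subtype.ext hx⟩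

/-- Take `a` with the largest closed neighbourhood inside `W`. By comparability and maximality,
every neighbour of `a` in `W` has its closed neighbourhood within `W` contained in that of `a`, so
no edge leaves the latter. -/
theorem HasShortChords.exists_dominating_or_separation (h : HasShortChords G) {W : Set V}
    (hW : W.Nonempty) :
    (∃ a W', a ∉ W' ∧ (∀ i ∈ W', G.Adj a i) ∧ insert a W' = W) ∨
      ∃ A B : Set V, A.Nonempty ∧ B.Nonempty ∧ Disjoint A B ∧
        (∀ i ∈ A, ∀ j ∈ B, ¬ G.Adj i j) ∧ A ∪ B = W := by
  obtain ⟨a, ha, hmax⟩ :=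
    Set.exists_max_image W (fun a => (closedNbhd G a ∩ W).ncard) (Set.toFinite _) hW
  by_cases hsub : W ⊆ closedNbhd G a
  · refine .inl ⟨a, W \ {a}, by simp, fun i hi => (hsub hi.1).resolve_left hi.2, ?_⟩
    rw [Set.insert_sdiff_singleton, Set.insert_eq_of_mem ha]
  · refine .inr ⟨W ∩ closedNbhd G a, W \ closedNbhd G a, ⟨a, ha, self_mem_closedNbhd a⟩,
      Set.sdiff_nonempty.2 hsub, ?_, ?_, Set.inter_union_sdiff _ _⟩
    · exact Set.disjoint_left.2 fun i hi hi' => hi'.2 hi.2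
    · rintro i ⟨hiW, hia⟩ j ⟨hjW, hja⟩ hij
      rcases h.closedNbhd_subset_or hia with hle | hle
      · have := Set.eq_of_subset_of_ncard_le (Set.inter_subset_inter_left W hle) (hmax i hiW)
          (Set.toFinite _)
        exact hja (this.ge ⟨.inr hij, hjW⟩).1
      · exact hja (hle (.inr hij))

theorem HasShortChords.isStronglyKoszulMonoid_and_hasTrivialMonoidAlgebra (k : Type u) [Field k]
    (h : HasShortChords G) (W : Set V) :
    IsStronglyKoszulMonoid (stableDegree G W) ∧
      HasTrivialMonoidAlgebra k (stableDegree G W) := by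
  induction hn : W.ncard using Nat.strong_induction_on generalizing W with
  | _ n ih =>
    subst hn
    rcases W.eq_empty_or_nonempty with rfl | hW
    · obtain ⟨e, he⟩ := exists_equiv_stableMonoid_empty G
      exact ⟨isStronglyKoszulMonoid_nat.of_equiv e he,
        (hasTrivialMonoidAlgebra_nat k).of_equiv e he⟩
    rcases h.exists_dominating_or_separation hW with
      ⟨a, W, ha, hadj, rfl⟩ | ⟨A, B, hA, hB, hdisj, hadj, rfl⟩
    · obtain ⟨e, he⟩ := exists_equiv_stableMonoid_insert ha hadj
      obtain ⟨h1, h2⟩ := ih W.ncard (by rw [Set.ncard_insert_of_notMem ha]; omega) W rfl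
      exact ⟨(IsStronglyKoszulMonoid.prod (isStandardMonoid_stableDegree G W)
        isStandardMonoid_nat h1 isStronglyKoszulMonoid_nat).of_equiv e he,
        (h2.prod (hasTrivialMonoidAlgebra_nat k)).of_equiv e he⟩
    · obtain ⟨e, he⟩ := exists_equiv_stableMonoid_union hdisj hadj
      have hA := (Set.ncard_pos (Set.toFinite _)).2 hA
      have hB := (Set.ncard_pos (Set.toFinite _)).2 hB
      have hAB := Set.ncard_union_eq hdisj (Set.toFinite _) (Set.toFinite _)
      obtain ⟨h1, h2⟩ := ih A.ncard (by omega) A rfl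
      obtain ⟨h3, h4⟩ := ih B.ncard (by omega) B rfl
      exact ⟨(IsStronglyKoszulMonoid.segre (isStandardMonoid_stableDegree G A)
        (isStandardMonoid_stableDegree G B) h1 h3).of_equiv e he, (h2.segre h4).of_equiv e he⟩

end StableMonoid

/-! ### Obstructions to strong Koszulness from induced `C₄` and `P₄` -/

theorem mem_or_mem_iff_of_stableExponent_add_eq {V : Type v} [Finite V] {S T S' T' : Set V}
    (h : stableExponent S + stableExponent T = stableExponent S' + stableExponent T') (i : V) :
    ((i ∈ S ∨ i ∈ T) ↔ (i ∈ S' ∨ i ∈ T')) ∧ ((i ∈ S ∧ i ∈ T) ↔ (i ∈ S' ∧ i ∈ T')) := by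
  classical
  have := DFunLike.congr_fun h (some i)
  simp only [Finsupp.add_apply, stableExponent_some] at this
  split_ifs at this <;> simp_all

theorem HasShortChords.of_isStronglyKoszulMonoid {V : Type v} [Finite V] {G : SimpleGraph V}
    (h : IsStronglyKoszulMonoid (stableDegree G Set.univ)) : HasShortChords G := by
  intro x a b y hxa hab hby hxb hay
  by_contra! hne
  obtain ⟨h1, h2⟩ := hne
  have hxy : x ≠ y := by
    rintro rfl
    exact h2 hxa.symm
  have hxa' := hxa.ne
  have hab' := hab.ne
  have hby' := hby.ne
  have mem {S : Set V} (hS : G.IsIndepSet S) : stableExponent S ∈ stableMonoid G Set.univ :=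
    stableExponent_mem (Set.subset_univ S) hS
  have single (i : V) : G.IsIndepSet {i} := Set.pairwise_singleton _ _
  have pair {i j : V} (hij : ¬ G.Adj i j) : G.IsIndepSet {i, j} := by
    rintro _ (rfl | rfl) _ (rfl | rfl) hne
    exacts [absurd rfl hne, hij, fun h => hij h.symm, absurd rfl hne]
  have not_mem {S : Set V} (hS : G.IsIndepSet S) {i j : V} (hij : G.Adj i j) (hi : i ∈ S) :
      j ∉ S := fun hj => hS hi hj hij.ne hij
  -- For `m` of degree two, the divisor, its cofactor and the remaining term all have degree one, so
  -- each is a stable set.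
  have factor {c e m m' : stableMonoid G Set.univ} (hc : stableDegree G _ c = 1)
      (he : stableDegree G _ e = 1) (hce : c ≠ e) (hm : m + c = e + m')
      (hm2 : stableDegree G _ m = 2) : ∃ S R T : Set V, G.IsIndepSet S ∧ G.IsIndepSet R ∧
        G.IsIndepSet T ∧ (m : Option V →₀ ℕ) = stableExponent S + stableExponent R ∧
        stableExponent S + (c : Option V →₀ ℕ) = e + stableExponent T := by
    obtain ⟨g, r, s, hg, rfl, hs⟩ := h c e m m' hc he hce hm
    have hr : stableDegree G _ r = 1 := by
      rw [map_add] at hm2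
      omega
    have hs1 : stableDegree G _ s = 1 := by
      have := congrArg (stableDegree G _) hs
      rw [map_add, map_add] at this
      omega
    obtain ⟨S, -, hS, hgS⟩ := exists_eq_stableExponent g.2 hg
    obtain ⟨R, -, hR, hrR⟩ := exists_eq_stableExponent r.2 hr
    obtain ⟨T, -, hT, hsT⟩ := exists_eq_stableExponent s.2 hs1
    refine ⟨S, R, T, hS, hR, hT, by rw [← hgS, ← hrR]; rfl, ?_⟩
    rw [← hgS, ← hsT]
    exact congrArg Subtype.val hs
  by_cases hadj : G.Adj x y
  -- The `C₄` case: `{y} + {x, b} + {a} = {x} + {b} + {a, y}`. A divisor `S` of `{y} + {x, b}` with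
  -- `x ∈ S` must be `{x, b}`, since `y` is adjacent to both `x` and `b`; then `T` contains the edge
  -- `ab`.
  · obtain ⟨S, R, T, hS, hR, hT, hm, hs⟩ := factor (c := ⟨_, mem (single a)⟩)
      (e := ⟨_, mem (single x)⟩) (m := ⟨_, mem (single y)⟩ + ⟨_, mem (pair h1)⟩)
      (m' := ⟨_, mem (single b)⟩ + ⟨_, mem (pair h2)⟩) rfl rfl
      (fun h => hxa.ne' (by simpa using stableExponent_injective (congrArg Subtype.val h)))
      (by
        classical
        apply Subtype.ext
        ext o
        cases o with
        | none => simp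
        | some i =>
          simp only [AddSubmonoid.coe_add, Finsupp.add_apply, stableExponent_some,
            Set.mem_singleton_iff, Set.mem_insert_iff]
          grind)
      rfl
    have hm := mem_or_mem_iff_of_stableExponent_add_eq hm
    have hs := mem_or_mem_iff_of_stableExponent_add_eq hs
    simp only [Set.mem_singleton_iff, Set.mem_insert_iff] at hm hs
    have := not_mem hS hadj
    have := not_mem hT hab
    have := not_mem hR hby
    grind
  -- The `P₄` case: `{a} + {b} + {x, y} = ∅ + {x, b} + {a, y}`. Here `T = S ∪ {x, y}` is stable, so
  -- `S` contains neither `a` nor `b`; then `R` contains the edge `ab`.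
  · obtain ⟨S, R, T, hS, hR, hT, hm, hs⟩ := factor (c := ⟨_, mem (pair hadj)⟩)
      (e := ⟨_, mem (Set.pairwise_empty _)⟩) (m := ⟨_, mem (single a)⟩ + ⟨_, mem (single b)⟩)
      (m' := ⟨_, mem (pair h1)⟩ + ⟨_, mem (pair h2)⟩) rfl rfl
      (fun h => (Set.insert_nonempty _ _).ne_empty
        (stableExponent_injective (congrArg Subtype.val h)))
      (by
        classical
        apply Subtype.ext
        ext o
        cases o with
        | none => simp
        | some i =>
          simp only [AddSubmonoid.coe_add, Finsupp.add_apply, stableExponent_some,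
            Set.mem_singleton_iff, Set.mem_insert_iff, Set.mem_empty_iff_false]
          grind)
      rfl
    have hm := mem_or_mem_iff_of_stableExponent_add_eq hm
    have hs := mem_or_mem_iff_of_stableExponent_add_eq hs
    simp only [Set.mem_singleton_iff, Set.mem_insert_iff, Set.mem_empty_iff_false] at hm hs
    have := not_mem hT hxa
    have := not_mem hT hby.symm
    have := not_mem hR hab
    grind

theorem IsMonomialBasis.isTrivialRing {k : Type u} [Field k] {M : Type v} [AddCommMonoid M]
    {d : M →+ ℕ} {R : Type w} [CommRing R] [Algebra k R] {A : ℕ → Submodule k R}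
    {b : Module.Basis M k R} (hb : IsMonomialBasis d A b) (h : HasTrivialMonoidAlgebra k d) :
    IsTrivialRing k A := by
  obtain ⟨S, _, _, B, hB, c, hc⟩ := h
  let e : R ≃ₗ[k] S := b.equiv c (Equiv.refl M)
  have he (m : M) : e (b m) = c m := by simp [e]
  have hmul : (LinearMap.mul k R).compr₂ e.toLinearMap =
      (LinearMap.mul k S).compl₁₂ e.toLinearMap e.toLinearMap :=
    b.ext fun m => b.ext fun n => by simp [← hb.map_add, ← hc.map_add, he]
  refine ⟨S, _, _, B, hB, AlgEquiv.ofLinearEquiv e (by rw [← hb.map_zero, he, hc.map_zero])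
    (fun x y => LinearMap.congr_fun₂ hmul x y), fun n => ?_⟩
  rw [hb.grading, hc.grading]
  change (Submodule.span k _).map e.toLinearMap = _
  rw [Submodule.map_span, Set.image_image]
  simp only [LinearEquiv.coe_coe, he]

/-! ### The toric ring of the stable set polytope -/

section ToricRing

variable {V : Type v} {G : SimpleGraph V}

/-- The polytope lies in the unit cube, and a 0/1 vector is already extreme there. -/
theorem incidenceVector_mem_extremePoints {S : Set V} (hS : G.IsIndepSet S) :
    incidenceVector S ∈ Set.extremePoints ℝ (stableSetPolytope G) := by
  classical
  have hsub : stableSetPolytope G ⊆ Set.univ.pi fun _ => Set.Icc (0 : ℝ) 1 := by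
    refine convexHull_min ?_ (convex_pi fun _ _ => convex_Icc 0 1)
    rintro _ ⟨T, -, rfl⟩ i -
    by_cases hi : i ∈ T <;> simp [incidenceVector, hi]
  refine inter_extremePoints_subset_extremePoints_of_subset hsub
    ⟨subset_convexHull ℝ _ ⟨S, hS, rfl⟩, ?_⟩
  rw [extremePoints_pi]
  intro i _
  rw [Set.extremePoints_Icc zero_le_one]
  by_cases hi : i ∈ S <;> simp [incidenceVector, hi]

theorem mem_extremePoints_stableSetPolytope {x : V → ℝ} :
    x ∈ Set.extremePoints ℝ (stableSetPolytope G) ↔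
      ∃ S : Set V, G.IsIndepSet S ∧ x = incidenceVector S := by
  constructor
  · exact fun h => extremePoints_convexHull_subset (𝕜 := ℝ)
      (A := {x | ∃ S : Set V, G.IsIndepSet S ∧ x = incidenceVector S}) h
  · rintro ⟨S, hS, rfl⟩
    exact incidenceVector_mem_extremePoints hS

variable [Fintype V] (k : Type u) [Field k]

theorem toricMonomial_indicator (S : Set V) :
    toricMonomial k (S.indicator 1) = MvPolynomial.monomial (stableExponent S) 1 := by
  classical
  rw [MvPolynomial.monomial_eq, Finsupp.prod_fintype _ _ (by simp), Fintype.prod_option]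
  simp [toricMonomial, stableExponent_some, Set.indicator_apply]

theorem vertexMonomials_stableSetPolytope (G : SimpleGraph V) :
    vertexMonomials k (stableSetPolytope G) =
      (fun m => MvPolynomial.monomial m 1) ''
        (stableExponent '' {S : Set V | S ⊆ Set.univ ∧ G.IsIndepSet S}) := by
  classical
  have hcast (S : Set V) : (fun i => ((S.indicator (1 : V → ℕ) i : ℕ) : ℝ)) = incidenceVector S := by
    ext i
    by_cases hi : i ∈ S <;> simp [incidenceVector, hi]
  ext f
  simp only [vertexMonomials, mem_extremePoints_stableSetPolytope, Set.mem_ofPred_eq]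
  constructor
  · rintro ⟨a, ⟨S, hS, ha⟩, rfl⟩
    have : a = S.indicator 1 := by
      ext i
      rw [← hcast] at ha
      exact_mod_cast congrFun ha i
    subst this
    exact ⟨_, ⟨S, ⟨Set.subset_univ S, hS⟩, rfl⟩, (toricMonomial_indicator k S).symm⟩
  · rintro ⟨_, ⟨S, ⟨-, hS⟩, rfl⟩, rfl⟩
    exact ⟨S.indicator 1, ⟨S, hS, hcast S⟩, (toricMonomial_indicator k S).symm⟩

theorem toricRing_eq_span (G : SimpleGraph V) :
    Subalgebra.toSubmodule (toricRing k (stableSetPolytope G)) =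
      Submodule.span k (Set.range fun m : stableMonoid G Set.univ =>
        MvPolynomial.basisMonomials (Option V) k m) := by
  rw [toricRing, vertexMonomials_stableSetPolytope]
  simp only [MvPolynomial.coe_basisMonomials]
  apply le_antisymm
  · let T : Submonoid (MvPolynomial (Option V) k) :=
      { carrier := Set.range fun m : stableMonoid G Set.univ =>
          MvPolynomial.monomial (m : Option V →₀ ℕ) 1
        one_mem' := ⟨0, rfl⟩
        mul_mem' := by
          rintro _ _ ⟨m, rfl⟩ ⟨n, rfl⟩
          exact ⟨m + n, by simp [MvPolynomial.monomial_mul]⟩ }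
    rw [Algebra.adjoin_eq_span]
    refine Submodule.span_mono ?_
    change _ ⊆ (T : Set (MvPolynomial (Option V) k))
    rw [SetLike.coe_subset_coe, Submonoid.closure_le]
    rintro _ ⟨m, hm, rfl⟩
    exact ⟨⟨m, AddSubmonoid.subset_closure hm⟩, rfl⟩
  · rw [Submodule.span_le]
    rintro _ ⟨⟨m, hm⟩, rfl⟩
    rw [SetLike.mem_coe, Subalgebra.mem_toSubmodule]
    simp only
    induction hm using AddSubmonoid.closure_induction with
    | mem m hm => exact Algebra.subset_adjoin ⟨m, hm, rfl⟩
    | zero => exact one_mem _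
    | add m n _ _ hm hn =>
      have := mul_mem hm hn
      rwa [MvPolynomial.monomial_mul, one_mul] at this

/-- The basis of monomials of the toric ring of the stable set polytope. -/
noncomputable def toricBasis (G : SimpleGraph V) :
    Module.Basis (stableMonoid G Set.univ) k (toricRing k (stableSetPolytope G)) :=
  (Module.Basis.span ((MvPolynomial.basisMonomials (Option V) k).linearIndependent.comp
    ((↑) : stableMonoid G Set.univ → Option V →₀ ℕ) Subtype.coe_injective)).map
    (LinearEquiv.ofEq _ _ (toricRing_eq_span k G).symm)

theorem coe_toricBasis (m : stableMonoid G Set.univ) :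
    (toricBasis k G m : MvPolynomial (Option V) k) =
      MvPolynomial.monomial (m : Option V →₀ ℕ) 1 := by
  rw [toricBasis, Module.Basis.map_apply, LinearEquiv.coe_ofEq_apply, Module.Basis.span_apply]
  rfl

/-- Coordinates are polynomial coefficients, so the degree in `T` can be read off the support; this
identifies the grading. -/
theorem toricBasis_repr_apply (x : toricRing k (stableSetPolytope G))
    (m : stableMonoid G Set.univ) :
    (toricBasis k G).repr x m = MvPolynomial.coeff m (x : MvPolynomial (Option V) k) := by
  classical
  have : Finsupp.lapply m ∘ₗ (toricBasis k G).repr.toLinearMap =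
      MvPolynomial.lcoeff k (m : Option V →₀ ℕ) ∘ₗ
        (toricRing k (stableSetPolytope G)).val.toLinearMap :=
    (toricBasis k G).ext fun n => by
      simp [coe_toricBasis, MvPolynomial.coeff_monomial, Finsupp.single_apply]
  exact LinearMap.congr_fun this x

open Classical in
theorem weight_toricGrading (m : Option V →₀ ℕ) :
    Finsupp.weight (fun o : Option V => if o = none then (1 : ℕ) else 0) m = m none := by
  rw [Finsupp.weight_apply, Finsupp.sum_fintype _ _ (by simp), Fintype.sum_option]
  simp

theorem isMonomialBasis_toricBasis (G : SimpleGraph V) :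
    IsMonomialBasis (stableDegree G Set.univ) (toricGrading k (stableSetPolytope G))
      (toricBasis k G) where
  map_zero := Subtype.ext (by rw [coe_toricBasis]; rfl)
  map_add m n := Subtype.ext (by
    rw [Subalgebra.coe_mul]
    simp [coe_toricBasis, MvPolynomial.monomial_mul])
  grading n := by
    apply le_antisymm
    · intro x hx
      rw [Module.Basis.mem_span_image]
      intro m hm
      rw [Finset.mem_coe, Finsupp.mem_support_iff, toricBasis_repr_apply] at hm
      have := hx hm
      rwa [weight_toricGrading] at this
    · rw [Submodule.span_le]
      rintro _ ⟨m, hm, rfl⟩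
      change MvPolynomial.IsWeightedHomogeneous _ (toricBasis k G m : MvPolynomial (Option V) k) n
      rw [coe_toricBasis]
      refine MvPolynomial.isWeightedHomogeneous_monomial _ _ _ ?_
      rw [weight_toricGrading]
      exact hm

theorem ListsVertexMonomials.exists_eq {t : ℕ} {u : Fin t → toricRing k (stableSetPolytope G)}
    (hu : ListsVertexMonomials k (stableSetPolytope G) u) :
    ∃ g : Fin t → stableMonoid G Set.univ, Function.Injective g ∧
      Set.range g = {m | stableDegree G Set.univ m = 1} ∧ u = fun i => toricBasis k G (g i) := by
  obtain ⟨hinj, hrange⟩ := hu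
  rw [vertexMonomials_stableSetPolytope] at hrange
  have hex (i : Fin t) : ∃ m, stableDegree G Set.univ m = 1 ∧ u i = toricBasis k G m := by
    obtain ⟨_, ⟨S, ⟨hSW, hS⟩, rfl⟩, h⟩ := hrange.subset ⟨i, rfl⟩
    refine ⟨⟨_, stableExponent_mem hSW hS⟩, rfl, Subtype.ext ?_⟩
    rw [coe_toricBasis]
    exact h.symm
  choose g hg1 hg using hex
  refine ⟨g, fun i j hij => hinj (by rw [hg, hg, hij]), ?_, funext hg⟩
  apply subset_antisymm
  · rintro _ ⟨i, rfl⟩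
    exact hg1 i
  · intro m hm
    obtain ⟨S, hSW, hS, h⟩ := exists_eq_stableExponent m.2 hm
    obtain ⟨i, hi⟩ := hrange.superset ⟨_, ⟨S, ⟨hSW, hS⟩, rfl⟩, rfl⟩
    refine ⟨i, (toricBasis k G).injective (Subtype.ext ?_)⟩
    rw [← hg, coe_toricBasis, h]
    exact hi

theorem exists_listsVertexMonomials (G : SimpleGraph V) :
    ∃ (t : ℕ) (u : Fin t → toricRing k (stableSetPolytope G)),
      ListsVertexMonomials k (stableSetPolytope G) u := by
  have hfin : (vertexMonomials k (stableSetPolytope G)).Finite := by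
    rw [vertexMonomials_stableSetPolytope]
    exact ((Set.toFinite _).image _).image _
  have := hfin.to_subtype
  obtain ⟨t, ⟨e⟩⟩ := Finite.exists_equiv_fin (vertexMonomials k (stableSetPolytope G))
  refine ⟨t, fun i => ⟨e.symm i, Algebra.subset_adjoin (e.symm i).2⟩, ?_, ?_⟩
  · intro i j hij
    exact e.symm.injective (Subtype.ext (congrArg (fun x => x.1) hij))
  · exact (e.symm.surjective.range_comp _).trans Subtype.range_coe

end ToricRing

theorem theorem1p3 (k : Type u) [Field k] {V : Type v} [Fintype V] (G : SimpleGraph V) :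
    [ IsStronglyKoszulToricRing k (stableSetPolytope G),
      ∀ (t : ℕ) (x : Fin t → toricRing k (stableSetPolytope G)),
        ListsVertexMonomials k (stableSetPolytope G) x →
          IsStronglyKoszulWith (toricGrading k (stableSetPolytope G)) x,
      IsTriviallyPerfect G,
      ¬ (SimpleGraph.cycleGraph 4).IsIndContained G ∧
        ¬ (SimpleGraph.pathGraph 4).IsIndContained G ].TFAE ∧
    (IsStronglyKoszulToricRing k (stableSetPolytope G) →
      IsTrivialRing k (toricGrading k (stableSetPolytope G))) := by
  have hb := isMonomialBasis_toricBasis k G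
  have h14 : IsStronglyKoszulToricRing k (stableSetPolytope G) → HasShortChords G := by
    rintro ⟨t, x, hx, h⟩
    obtain ⟨g, -, hg, rfl⟩ := hx.exists_eq
    exact .of_isStronglyKoszulMonoid (hb.isStronglyKoszulMonoid hg h)
  refine ⟨?_, fun h => hb.isTrivialRing
    ((h14 h).isStronglyKoszulMonoid_and_hasTrivialMonoidAlgebra k _).2⟩
  rw [← hasShortChords_iff]
  tfae_have 1 → 4 := h14
  tfae_have 4 → 2 := by
    intro h t x hx
    obtain ⟨g, hinj, hg, rfl⟩ := hx.exists_eq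
    exact hb.isStronglyKoszulWith (isStandardMonoid_stableDegree G _)
      (h.isStronglyKoszulMonoid_and_hasTrivialMonoidAlgebra k _).1 hinj hg
  tfae_have 2 → 1 := by
    intro h
    obtain ⟨t, x, hx⟩ := exists_listsVertexMonomials k G
    exact ⟨t, x, hx, h t x hx⟩
  tfae_have 3 ↔ 4 := isTriviallyPerfect_iff_hasShortChords
  tfae_finish
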